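/- Fix $\omega_0,\epsilon_F>0$. For $T>0$ let $f(x)=1/(e^x+1)$, $n(x)=1/(e^x-1)$, $w(\epsilon)=f(\epsilon/T)\,[1-f(\epsilon/T)]$, $$\bar K_0(\epsilon,u)=\Big(\frac{T}{\omega_0}\Big)^2\big[n(y)+f(y+\epsilon/T)\big]\,y^2\,\mathrm{sgn}(y),\qquad y=\frac{u-\epsilon}{T},$$ $$\bar K_1(\epsilon,u)=\frac{u-\epsilon}{2\epsilon_F}\,\bar K_0(\epsilon,u),\qquad \bar K_2(\epsilon,u)=\frac{(u-\epsilon)^2}{2\omega_0^2}\,\bar K_0(\epsilon,u),$$ $\Gamma_\nu(\epsilon)=\int_{\mathbb R}\bar K_\nu(\epsilon,u)\,du$ and $K_\nu(\epsilon,u)=\bar K_\nu(\epsilon,u)/\Gamma_0(\epsilon)$ for $\nu=0,1,2$. Write $K_\nu$ also for the integral operator $(K_\nu\varphi)(\epsilon)=\int_{\mathbb R}K_\nu(\epsilon,u)\varphi(u)\,du$, let $L^2_\sigma$ be the space of real functions that are square integrable with respect to $d\sigma(\epsilon)=w(\epsilon)\Gamma_0(\epsilon)\,d\epsilon$, with norm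 $\|\cdot\|$, and let $$(\mathcal C_0\varphi)(\epsilon)=\int_{\mathbb R}K_0(\epsilon,u+\epsilon)\,[\varphi(u+\epsilon)-\varphi(\epsilon)]\,du .$$ (All of these depend on $T$.) For families $f_T,g_T\in L^2_\sigma$ say that $f_T=g_T$ to leading order for $T\to0$ if $\|f_T-g_T\|=o(\|g_T\|)$ as $T\to0^+$. 1. For every $T>0$ and every odd $f\in L^2_\sigma$ the Neumann series $\sum_{m\ge0}(K_0)^m f$ converges in $L^2_\sigma$. 2. For every $T>0$ the function $\Gamma_1/\Gamma_0$ is an odd element of $L^2_\sigma$, and so is $S_T=\sum_{m\ge0}(K_0)^m(\Gamma_1/\Gamma_0)$. For every constant $\phi_+\in\mathbb R$, the function $\phi_+S_T$ is the unique odd solution $\varphi_-\in L^2_\sigma$ of the leading-order equation $\mathcal C_0\varphi_-=-K_1\phi_+$. 3. There is $T_0>0$ such that for $0<T<T_0$ the integral equation $$\varphi(\epsilon)=\frac1{\Gamma_0(\epsilon)}+\int_{\mathbb R}\big[K_0+K_1-K_2\big](\epsilon,u)\,\varphi(u)\,du$$ has exactly one solution $\varphi\in L^2_\sigma$. Let $\varphi_\pm(\epsilon)=[\varphi(\epsilon)\pm\varphi(-\epsilon)]/2$.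 To leading order for $T\to0$ the even part is a constant: $\varphi_+=C\,T^{-5}$ to leading order for some constant $C>0$. For every choice of constants $\phi_+=\phi_+(T)$ with $\varphi_+=\phi_+$ to leading order, the odd part is $$\varphi_-=\phi_+\sum_{m=0}^\infty (K_0)^m\,\frac{\Gamma_1}{\Gamma_0}\qquad\text{to leading order for }T\to0 .$$ -/

import Mathlib

open MeasureTheory Filter Topology

namespace ElectronPhonon

noncomputable section

/-- Fermi distribution function. -/
def fermi (x : ℝ) : ℝ := 1 / (Real.exp x + 1)

/-- Bose distribution function. It is only ever multiplied by a function that vanishes to second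
order at `0`, so the value at `0` plays no role. -/
def bose (x : ℝ) : ℝ := 1 / (Real.exp x - 1)

/-- The weight function `w(ε) = f₀(ε/T) (1 - f₀(ε/T))`. -/
def weight (T ε : ℝ) : ℝ := fermi (ε / T) * (1 - fermi (ε / T))

/-- The dimensionless phonon kernel `k̄₀(x, y) = [n(y) + f(y + x)] y² sgn y`. -/
def kbar (x y : ℝ) : ℝ := (bose y + fermi (y + x)) * y ^ 2 * Real.sign y

/-- The kernel `K̄₀(ε, u)`. -/
def Kbar₀ (ω₀ T ε u : ℝ) : ℝ := (T / ω₀) ^ 2 * kbar (ε / T) ((u - ε) / T)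

/-- The kernel `K̄₁(ε, u)`. -/
def Kbar₁ (ω₀ εF T ε u : ℝ) : ℝ :=
  ω₀ / (2 * εF) * (T / ω₀) * ((u - ε) / T) * Kbar₀ ω₀ T ε u

/-- The kernel `K̄₂(ε, u)`. -/
def Kbar₂ (ω₀ T ε u : ℝ) : ℝ :=
  1 / 2 * (T / ω₀) ^ 2 * ((u - ε) / T) ^ 2 * Kbar₀ ω₀ T ε u

/-- The single-particle rate `Γ₀(ε) = ∫ du K̄₀(ε, u)`. -/
def Γ₀ (ω₀ T ε : ℝ) : ℝ := ∫ u, Kbar₀ ω₀ T ε u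

/-- The rate `Γ₁(ε) = ∫ du K̄₁(ε, u)`. -/
def Γ₁ (ω₀ εF T ε : ℝ) : ℝ := ∫ u, Kbar₁ ω₀ εF T ε u

/-- The kernels `K_ν = K̄_ν / Γ₀(ε)`, `ν = 0, 1, 2`. -/
def K₀ (ω₀ T ε u : ℝ) : ℝ := Kbar₀ ω₀ T ε u / Γ₀ ω₀ T ε

/-- See `K₀`. -/
def K₁ (ω₀ εF T ε u : ℝ) : ℝ := Kbar₁ ω₀ εF T ε u / Γ₀ ω₀ T ε

/-- See `K₀`. -/
def K₂ (ω₀ T ε u : ℝ) : ℝ := Kbar₂ ω₀ T ε u / Γ₀ ω₀ T ε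

/-- The full kernel `K = K₀ + K₁ - K₂`. -/
def Kfull (ω₀ εF T ε u : ℝ) : ℝ := K₀ ω₀ T ε u + K₁ ω₀ εF T ε u - K₂ ω₀ T ε u

/-- The integral operator with kernel `k`: `(k φ)(ε) = ∫ du k(ε, u) φ(u)`. -/
def intOp (k : ℝ → ℝ → ℝ) (φ : ℝ → ℝ) (ε : ℝ) : ℝ := ∫ u, k ε u * φ u

/-- The measure `dσ(ε) = w(ε) Γ₀(ε) dε`; `L²_σ` is the set of functions `φ` with
`MemLp φ 2 (σ ω₀ T)`, taken up to almost everywhere equality. -/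
def σ (ω₀ T : ℝ) : Measure ℝ :=
  volume.withDensity fun ε => ENNReal.ofReal (weight T ε * Γ₀ ω₀ T ε)

/-- The collision operator
`(C₀ φ)(ε) = ∫ du K₀(ε, u + ε) [φ(u + ε) - φ(ε)]`. -/
def C₀ (ω₀ T : ℝ) (φ : ℝ → ℝ) (ε : ℝ) : ℝ :=
  ∫ u, K₀ ω₀ T ε (u + ε) * (φ (u + ε) - φ ε)

/-- `φ ∈ L²_σ` solves the integral equation `φ(ε) = 1/Γ₀(ε) + ∫ du K(ε, u) φ(u)`. -/
def IsSolution (ω₀ εF T : ℝ) (φ : ℝ → ℝ) : Prop :=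
  MemLp φ 2 (σ ω₀ T) ∧
    ∀ᵐ ε, φ ε = 1 / Γ₀ ω₀ T ε + intOp (Kfull ω₀ εF T) φ ε

/-- Even part of a function. -/
def evenPart (φ : ℝ → ℝ) (ε : ℝ) : ℝ := (φ ε + φ (-ε)) / 2

/-- Odd part of a function. -/
def oddPart (φ : ℝ → ℝ) (ε : ℝ) : ℝ := (φ ε - φ (-ε)) / 2

/-- `φ` is an odd element of `L²_σ`. -/
def IsOddL2 (ω₀ T : ℝ) (φ : ℝ → ℝ) : Prop :=
  MemLp φ 2 (σ ω₀ T) ∧ ∀ᵐ ε, φ (-ε) = -φ ε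

/-- `∑_{m ≥ 0} (K₀)^m f = S` in `L²_σ`: all terms and the sum lie in `L²_σ`, and the partial sums
converge to `S` in norm. -/
def HasNeumannSum (ω₀ T : ℝ) (f S : ℝ → ℝ) : Prop :=
  (∀ m : ℕ, MemLp ((intOp (K₀ ω₀ T))^[m] f) 2 (σ ω₀ T)) ∧
  MemLp S 2 (σ ω₀ T) ∧
  Tendsto (fun N : ℕ =>
      eLpNorm (fun ε => (∑ m ∈ Finset.range N, (intOp (K₀ ω₀ T))^[m] f ε) - S ε) 2 (σ ω₀ T))
    atTop (𝓝 0)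

/-- `f_T = g_T` to leading order for `T → 0`: the error `‖f_T - g_T‖` is `o(‖g_T‖)` as `T → 0+`,
in the norm of `L²_σ` (which depends on `T`). -/
def LeadingOrder (ω₀ : ℝ) (f g : ℝ → ℝ → ℝ) : Prop :=
  ∀ δ : ℝ, 0 < δ → ∀ᶠ T in 𝓝[>] (0 : ℝ),
    eLpNorm (fun ε => f T ε - g T ε) 2 (σ ω₀ T) ≤
      ENNReal.ofReal δ * eLpNorm (g T) 2 (σ ω₀ T)

end

end ElectronPhonon

open ElectronPhonon

open MeasureTheory Filter Topology

namespace ElectronPhonon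

noncomputable section

open scoped RealInnerProductSpace

/-! The substitution ε = Tx, φ ↦ `amplitude`(x) φ(Tx) maps L²_σ onto L²(ℝ), and multiplies norms by
a factor that depends only on T and ω₀. By `kbar_eq` the kernels become p(z-x), (z-x)p(z-x) and
(z-x)²p(z-x), each divided by 2√(g(x)g(z)), with p the phonon spectrum and g = `rate`. Parity of the
profile makes the operators K and B symmetric and A antisymmetric, and none depends on T. With α =
1/(2ε_F), β = 1/(2ω₀²), Ω = ω₀² the integral equation reads (1 - K - αT A + βT² B)X = (Ω/T³) q.

The image v of the constant 1 is fixed by K. Square integrability of the kernel makes K compact. A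
Dirichlet form (`integral_dirichletDensity`) shows that ‖K‖ ≤ 1, that only multiples of v are fixed,
and that -1 is not an eigenvalue. Hence K is a strict contraction on the complement of v
(`exists_strict_contraction_of_compact`). Odd functions are orthogonal to v, so their Neumann series
converge geometrically and give the unique odd solution of the leading-order equation.

For the full equation, take X ≈ (C/T⁵)(v + αT o + T² e), with o the Neumann sum of Av. Orders 0 and
1 hold identically. Order 2 is solvable for e only if its right side is orthogonal to v, and this
fixes C > 0. The residual is controlled by coercivity: A drops out of the quadratic form, the gap
controls the complement of v, and βT²⟨v,Bv⟩ > 0 controls the v direction (`pencil_coercive`,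
`pencil_estimate`). The errors are O(T⁻³) in the even part and O(T⁻²) in the odd part, against T⁻⁵
and T⁻⁴. Since Av ≠ 0, the odd leading term does not vanish and the comparison is a relative one. -/

/-! ### Spectral gap from compactness -/

/-- A compact self-adjoint contraction whose eigenvalues `1` and `-1` have eigenspaces contained in
the line of `v` and in `0` is a strict contraction on the orthogonal complement of `v`. -/
theorem exists_strict_contraction_of_compact {H : Type*} [NormedAddCommGroup H]
    [InnerProductSpace ℝ H] (K : H →L[ℝ] H) (v : H)
    (hcomp : IsCompactOperator K) (hsymm : ∀ x y, ⟪K x, y⟫ = ⟪x, K y⟫)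
    (hnorm : ∀ x, ‖K x‖ ≤ ‖x‖) (hKv : K v = v)
    (hfix : ∀ x, K x = x → ∃ c : ℝ, x = c • v) (hneg : ∀ x, K x = -x → x = 0) :
    ∃ ρ : ℝ, 0 ≤ ρ ∧ ρ < 1 ∧ ∀ x, ⟪v, x⟫ = 0 → ‖K x‖ ≤ ρ * ‖x‖ := by
  by_contra! hcon
  -- Without a gap, each ρ = 1 - 1/(n+1) has a violating vector; normalized, these almost attain
  -- norm 1.
  have hseq : ∀ n : ℕ, ∃ x : H, ⟪v, x⟫ = 0 ∧ ‖x‖ = 1 ∧ 1 - 1 / ((n : ℝ) + 1) < ‖K x‖ := by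
    intro n
    have hn : (0 : ℝ) < (n : ℝ) + 1 := by positivity
    have h1 : (1 : ℝ) / ((n : ℝ) + 1) ≤ 1 := by
      rw [div_le_one hn]; linarith [(Nat.cast_nonneg n : (0 : ℝ) ≤ n)]
    obtain ⟨x, hx, hx'⟩ := hcon (1 - 1 / ((n : ℝ) + 1)) (by linarith)
      (by have : (0 : ℝ) < 1 / ((n : ℝ) + 1) := by positivity
          linarith)
    have hx0 : x ≠ 0 := by
      rintro rfl; simp at hx'
    have hxn : 0 < ‖x‖ := norm_pos_iff.2 hx0
    refine ⟨‖x‖⁻¹ • x, by simp [inner_smul_right, hx], ?_, ?_⟩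
    · rw [norm_smul, norm_inv, norm_norm, inv_mul_cancel₀ hxn.ne']
    · rw [map_smul, norm_smul, norm_inv, norm_norm, inv_mul_eq_div, lt_div_iff₀ hxn]
      exact hx'
  choose x hxv hx1 hxK using hseq
  obtain ⟨C, hC, hsub⟩ := hcomp.image_closedBall_subset_compact (f := (K : H →ₗ[ℝ] H)) 1
  have hmem : ∀ n, K (x n) ∈ C := fun n =>
    hsub ⟨x n, by simp [hx1 n], rfl⟩
  obtain ⟨y, -, φ, hφ, hy⟩ := hC.tendsto_subseq hmem
  have hKlim : Tendsto (fun n => ‖K (x n)‖) atTop (𝓝 1) := by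
    have h0 : Tendsto (fun n : ℕ => 1 - 1 / ((n : ℝ) + 1)) atTop (𝓝 1) := by
      simpa using (tendsto_const_nhds (x := (1 : ℝ))).sub tendsto_one_div_add_atTop_nhds_zero_nat
    exact tendsto_of_tendsto_of_tendsto_of_le_of_le h0 tendsto_const_nhds
      (fun n => (hxK n).le) (fun n => (hnorm _).trans_eq (hx1 n))
  -- Symmetry turns the cross term into ‖Kx‖², so a nearly norm-preserved x is nearly fixed by K².
  -- Compactness gives convergence of Kx along a subsequence, and this carries it over to x.
  have hdiff : ∀ n, ‖K (K (x n)) - x n‖ ^ 2 ≤ 2 - 2 * ‖K (x n)‖ ^ 2 := by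
    intro n
    have e := norm_sub_sq_real (K (K (x n))) (x n)
    have e2 : ⟪K (K (x n)), x n⟫ = ‖K (x n)‖ ^ 2 := by
      rw [hsymm, real_inner_self_eq_norm_sq]
    have e3 : ‖K (K (x n))‖ ≤ 1 := (hnorm _).trans ((hnorm _).trans_eq (hx1 n))
    rw [e, e2, hx1]
    nlinarith [norm_nonneg (K (K (x n)))]
  have hdiff0 : Tendsto (fun n => K (K (x n)) - x n) atTop (𝓝 0) := by
    rw [tendsto_zero_iff_norm_tendsto_zero]
    have h2 : Tendsto (fun n => ‖K (K (x n)) - x n‖ ^ 2) atTop (𝓝 0) := by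
      refine squeeze_zero (fun n => by positivity) hdiff ?_
      have := (tendsto_const_nhds (x := (2 : ℝ))).sub ((hKlim.pow 2).const_mul 2)
      simpa using this
    have := h2.sqrt
    simpa [Real.sqrt_sq] using this
  have hKy : Tendsto (fun n => K (K (x (φ n)))) atTop (𝓝 (K y)) :=
    (K.continuous.tendsto y).comp hy
  have hxlim : Tendsto (fun n => x (φ n)) atTop (𝓝 (K y)) := by
    have := hKy.sub (hdiff0.comp hφ.tendsto_atTop)
    simpa using this
  set ψ := K y with hψ
  have hψ1 : ‖ψ‖ = 1 := by
    have := hxlim.norm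
    simp only [hx1] at this
    exact (tendsto_nhds_unique this tendsto_const_nhds)
  have hψv : ⟪v, ψ⟫ = 0 := by
    have h := (tendsto_const_nhds (x := v)).inner (𝕜 := ℝ) hxlim
    simp only [hxv] at h
    exact tendsto_nhds_unique h tendsto_const_nhds
  have hyψ : y = K ψ := tendsto_nhds_unique hy ((K.continuous.tendsto ψ).comp hxlim)
  have hKKψ : K (K ψ) = ψ := by rw [← hyψ]
  -- K²ψ = ψ makes ψ + Kψ a fixed vector, hence a multiple of v. It is also orthogonal to v, so Kψ =
  -- -ψ, which `hneg` excludes.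
  obtain ⟨c, hc⟩ := hfix (ψ + K ψ) (by rw [map_add, hKKψ, add_comm])
  have h0 : ⟪v, ψ + K ψ⟫ = 0 := by
    rw [inner_add_right, hψv, ← hsymm, hKv, hψv, add_zero]
  have h00 : ψ + K ψ = 0 := by
    rw [← inner_self_eq_zero (𝕜 := ℝ)]
    nth_rewrite 1 [hc]
    rw [inner_smul_left, h0, mul_zero]
  have hψ0 : ψ = 0 := hneg ψ (by rw [eq_neg_iff_add_eq_zero, add_comm]; exact h00)
  simp [hψ0] at hψ1

/-! ### Singular perturbation of 1 - K in an abstract Hilbert space -/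

/-- Abstract form of the low-temperature problem: a symmetric operator `K` with fixed vector `v`
and a spectral gap, an antisymmetric parity-reversing operator `A`, and a symmetric
parity-preserving operator `B`, where `N` is the parity. -/
structure LowTemperatureModel (H : Type*) [NormedAddCommGroup H] [InnerProductSpace ℝ H] where
  K : H →L[ℝ] H
  A : H →L[ℝ] H
  B : H →L[ℝ] H
  N : H →L[ℝ] H
  v : H
  q : H
  K_symm : ∀ x y, ⟪K x, y⟫ = ⟪x, K y⟫
  A_antisymm : ∀ x y, ⟪A x, y⟫ = -⟪x, A y⟫
  B_symm : ∀ x y, ⟪B x, y⟫ = ⟪x, B y⟫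
  N_symm : ∀ x y, ⟪N x, y⟫ = ⟪x, N y⟫
  N_N : ∀ x, N (N x) = x
  N_K : ∀ x, N (K x) = K (N x)
  N_A : ∀ x, N (A x) = -A (N x)
  N_B : ∀ x, N (B x) = B (N x)
  K_v : K v = v
  N_v : N v = v
  N_q : N q = q
  ρ : ℝ
  ρ_nonneg : 0 ≤ ρ
  ρ_lt_one : ρ < 1
  gap : ∀ x, ⟪v, x⟫ = 0 → ‖K x‖ ≤ ρ * ‖x‖
  B_pos : 0 < ⟪v, B v⟫
  q_pos : 0 < ⟪v, q⟫

namespace LowTemperatureModel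

variable {H : Type*} [NormedAddCommGroup H] [InnerProductSpace ℝ H]
  (m : LowTemperatureModel H)

theorem inner_v_K (x : H) : ⟪m.v, m.K x⟫ = ⟪m.v, x⟫ := by
  rw [← m.K_symm, m.K_v]

theorem inner_eq_zero_of_parity {x y : H} (hx : m.N x = x) (hy : m.N y = -y) : ⟪x, y⟫ = 0 := by
  have h := m.N_symm x y
  rw [hx, hy, inner_neg_right] at h
  linarith

theorem norm_N (x : H) : ‖m.N x‖ = ‖x‖ := by
  have h : ‖m.N x‖ ^ 2 = ‖x‖ ^ 2 := by
    rw [← real_inner_self_eq_norm_sq, m.N_symm, m.N_N, real_inner_self_eq_norm_sq]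
  exact (sq_eq_sq₀ (norm_nonneg _) (norm_nonneg _)).1 h

theorem inner_v_pow (x : H) (hx : ⟪m.v, x⟫ = 0) (n : ℕ) : ⟪m.v, (m.K ^ n) x⟫ = 0 := by
  induction n with
  | zero => simpa using hx
  | succ n ih => rw [pow_succ', mul_apply_eq_comp, m.inner_v_K, ih]

theorem norm_pow_le (x : H) (hx : ⟪m.v, x⟫ = 0) (n : ℕ) : ‖(m.K ^ n) x‖ ≤ m.ρ ^ n * ‖x‖ := by
  induction n with
  | zero => simp
  | succ n ih =>
    rw [pow_succ', mul_apply_eq_comp]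
    calc ‖m.K ((m.K ^ n) x)‖ ≤ m.ρ * ‖(m.K ^ n) x‖ := m.gap _ (m.inner_v_pow x hx n)
      _ ≤ m.ρ * (m.ρ ^ n * ‖x‖) := mul_le_mul_of_nonneg_left ih m.ρ_nonneg
      _ = m.ρ ^ (n + 1) * ‖x‖ := by ring

/-- The Neumann series `∑ Kⁿ x`. -/
def neumann (x : H) : H := ∑' n, (m.K ^ n) x

theorem summable_neumann [CompleteSpace H] (x : H) (hx : ⟪m.v, x⟫ = 0) :
    Summable fun n => (m.K ^ n) x :=
  Summable.of_norm_bounded ((summable_geometric_of_lt_one m.ρ_nonneg m.ρ_lt_one).mul_right ‖x‖)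
    (m.norm_pow_le x hx)

theorem neumann_sub [CompleteSpace H] (x : H) (hx : ⟪m.v, x⟫ = 0) :
    m.neumann x - m.K (m.neumann x) = x := by
  have hs := m.summable_neumann x hx
  have h1 : m.K (m.neumann x) = ∑' n, (m.K ^ (n + 1)) x := by
    rw [neumann, m.K.map_tsum hs]
    simp only [pow_succ', mul_apply_eq_comp]
  have h2 : m.neumann x = x + ∑' n, (m.K ^ (n + 1)) x := by
    rw [neumann, hs.tsum_eq_zero_add]; simp
  rw [h1]
  nth_rewrite 1 [h2]
  abel

theorem inner_v_neumann [CompleteSpace H] (x : H) (hx : ⟪m.v, x⟫ = 0) : ⟪m.v, m.neumann x⟫ = 0 := by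
  have h := (innerSL ℝ m.v).map_tsum (m.summable_neumann x hx)
  simp only [innerSL_apply_apply, m.inner_v_pow x hx, tsum_zero] at h
  exact h

theorem eq_zero_of_sub_eq_zero (x : H) (hx : ⟪m.v, x⟫ = 0) (h : x - m.K x = 0) : x = 0 := by
  have h1 := m.gap x hx
  rw [← sub_eq_zero.1 h] at h1
  have := m.ρ_lt_one
  by_contra hne
  have : 0 < ‖x‖ := norm_pos_iff.2 hne
  nlinarith

/-- The gap makes 1 - K injective on the complement of v. Linearity and parity of the series are
then read off the equation instead of the terms. -/
theorem eq_neumann [CompleteSpace H] (x y : H) (hx : ⟪m.v, x⟫ = 0) (hy : ⟪m.v, y⟫ = 0)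
    (h : y - m.K y = x) : y = m.neumann x := by
  rw [← sub_eq_zero]
  apply m.eq_zero_of_sub_eq_zero
  · rw [inner_sub_right, hy, m.inner_v_neumann x hx, sub_zero]
  · rw [map_sub]
    have := m.neumann_sub x hx
    rw [← sub_eq_zero.2 (h.trans this.symm)]
    abel

theorem neumann_smul [CompleteSpace H] (c : ℝ) (x : H) (hx : ⟪m.v, x⟫ = 0) :
    m.neumann (c • x) = c • m.neumann x := by
  refine (m.eq_neumann (c • x) (c • m.neumann x) ?_ ?_ ?_).symm
  · rw [inner_smul_right, hx, mul_zero]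
  · rw [inner_smul_right, m.inner_v_neumann x hx, mul_zero]
  · rw [map_smul, ← smul_sub, m.neumann_sub x hx]

theorem N_neumann_even [CompleteSpace H] (x : H) (hx : ⟪m.v, x⟫ = 0) (hN : m.N x = x) :
    m.N (m.neumann x) = m.neumann x := by
  apply m.eq_neumann _ _ hx
  · rw [← m.N_symm, m.N_v, m.inner_v_neumann x hx]
  · rw [← m.N_K, ← map_sub, m.neumann_sub x hx, hN]

theorem N_neumann_odd [CompleteSpace H] (x : H) (hx : ⟪m.v, x⟫ = 0) (hN : m.N x = -x) :
    m.N (m.neumann x) = -m.neumann x := by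
  have h : -m.N (m.neumann x) = m.neumann x := by
    apply m.eq_neumann _ _ hx
    · rw [inner_neg_right, ← m.N_symm, m.N_v, m.inner_v_neumann x hx, neg_zero]
    · rw [map_neg, ← m.N_K, ← neg_add_eq_sub, neg_neg, ← sub_eq_add_neg, ← map_sub,
        ← neg_sub, map_neg, m.neumann_sub x hx, hN, neg_neg]
  exact neg_eq_iff_eq_neg.1 h

theorem inner_v_of_odd {x : H} (hx : m.N x = -x) : ⟪m.v, x⟫ = 0 :=
  m.inner_eq_zero_of_parity m.N_v hx

theorem N_A_v : m.N (m.A m.v) = -m.A m.v := by rw [m.N_A, m.N_v]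

theorem coercive_on_orthogonal (x : H) (hx : ⟪m.v, x⟫ = 0) :
    (1 - m.ρ) * ‖x‖ ^ 2 ≤ ⟪x, x - m.K x⟫ := by
  rw [inner_sub_right, real_inner_self_eq_norm_sq]
  have h1 := real_inner_le_norm x (m.K x)
  have h2 := mul_le_mul_of_nonneg_left (m.gap x hx) (norm_nonneg x)
  nlinarith

/-- The operator `1 - K - αT A + βT² B`. -/
def pencil (α β T : ℝ) : H →L[ℝ] H :=
  ContinuousLinearMap.id ℝ H - m.K - (α * T) • m.A + (β * T ^ 2) • m.B

theorem pencil_apply (α β T : ℝ) (x : H) :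
    m.pencil α β T x = x - m.K x - (α * T) • m.A x + (β * T ^ 2) • m.B x := rfl

theorem inner_A_self (x : H) : ⟪x, m.A x⟫ = 0 := by
  have h := m.A_antisymm x x
  rw [real_inner_comm] at h
  linarith

/-- Coercivity of the pencil, with the weight `T²` in the direction of `v`. -/
theorem pencil_coercive {α β : ℝ} (hβ : 0 < β) :
    ∃ κ T₀ : ℝ, 0 < κ ∧ 0 < T₀ ∧ ∀ T, 0 < T → T < T₀ → ∀ (a : ℝ) (x : H), ⟪m.v, x⟫ = 0 →
      κ * (T ^ 2 * a ^ 2 + ‖x‖ ^ 2) ≤ ⟪a • m.v + x, m.pencil α β T (a • m.v + x)⟫ := by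
  set b := ⟪m.v, m.B m.v⟫ with hb
  have hb0 : 0 < b := m.B_pos
  set M := ‖m.B m.v‖ with hM
  have hM0 : 0 ≤ M := norm_nonneg _
  set M' := ‖m.B‖ with hM'
  have hM'0 : 0 ≤ M' := norm_nonneg _
  set γ := 1 - m.ρ with hγ
  have hγ0 : 0 < γ := by rw [hγ]; linarith [m.ρ_lt_one]
  -- The first summand is β times the total loss on the complement of v caused by B; T·D ≤ γ/2 lets
  -- half of the gap absorb it. The 1 keeps D positive and away from the degenerate case.
  set D := β * (2 * M ^ 2 / b + M') + 1 with hD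
  have hD0 : 0 < D := by positivity
  refine ⟨min (β * b / 2) (γ / 2), min 1 (γ / (2 * D)), by positivity, by positivity, ?_⟩
  intro T hT hTT a x hx
  have hT1 : T < 1 := hTT.trans_le (min_le_left _ _)
  have hT2 : T * D ≤ γ / 2 := by
    have := (hTT.trans_le (min_le_right _ _)).le
    rw [le_div_iff₀ (by positivity)] at this
    linarith
  have hDx : (a • m.v + x) - m.K (a • m.v + x) = x - m.K x := by
    rw [map_add, map_smul, m.K_v]; abel
  have e1 : ⟪a • m.v + x, x - m.K x⟫ = ⟪x, x - m.K x⟫ := by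
    rw [inner_add_left, inner_smul_left, inner_sub_right m.v, m.inner_v_K]; simp
  have e2 : ⟪a • m.v + x, m.B (a • m.v + x)⟫ =
      a ^ 2 * b + 2 * a * ⟪m.B m.v, x⟫ + ⟪x, m.B x⟫ := by
    simp only [map_add, map_smul, inner_add_left, inner_add_right, inner_smul_left,
      inner_smul_right, conj_trivial]
    rw [← m.B_symm m.v x, real_inner_comm (m.B m.v) x]
    ring
  -- A vanishes by antisymmetry, and 1 - K annihilates v from both sides, so along v only βT²b
  -- survives.
  have e : ⟪a • m.v + x, m.pencil α β T (a • m.v + x)⟫ =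
      ⟪x, x - m.K x⟫ + β * T ^ 2 * (a ^ 2 * b + 2 * a * ⟪m.B m.v, x⟫ + ⟪x, m.B x⟫) := by
    rw [pencil_apply, hDx, inner_add_right, inner_sub_right, inner_smul_right, inner_smul_right,
      m.inner_A_self, e1, e2]
    ring
  rw [e]
  have h1 := m.coercive_on_orthogonal x hx
  have h2 : |⟪m.B m.v, x⟫| ≤ M * ‖x‖ := abs_real_inner_le_norm _ _
  have h3 : |⟪x, m.B x⟫| ≤ M' * ‖x‖ ^ 2 := by
    refine (abs_real_inner_le_norm _ _).trans ?_
    have := mul_le_mul_of_nonneg_left (m.B.le_opNorm x) (norm_nonneg x)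
    linarith
  -- Young's inequality: half of a²b pays for the cross term.
  have h4 : -(a ^ 2 * b / 2 + 2 * M ^ 2 / b * ‖x‖ ^ 2) ≤ 2 * a * ⟪m.B m.v, x⟫ := by
    have h5 : |a * ⟪m.B m.v, x⟫| ≤ |a| * (M * ‖x‖) := by
      rw [abs_mul]; exact mul_le_mul_of_nonneg_left h2 (abs_nonneg a)
    have h6 : 2 * (|a| * (M * ‖x‖)) ≤ a ^ 2 * b / 2 + 2 * M ^ 2 / b * ‖x‖ ^ 2 := by
      have h7 : a ^ 2 * b / 2 + 2 * M ^ 2 / b * ‖x‖ ^ 2 - 2 * (|a| * (M * ‖x‖)) =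
          (|a| * b - 2 * (M * ‖x‖)) ^ 2 / (2 * b) := by
        rw [← sq_abs a]; field_simp; ring
      have h8 : 0 ≤ (|a| * b - 2 * (M * ‖x‖)) ^ 2 / (2 * b) := by positivity
      linarith
    have := (abs_le.1 h5).1
    linarith
  have h5 : a ^ 2 * b / 2 - (2 * M ^ 2 / b + M') * ‖x‖ ^ 2 ≤
      a ^ 2 * b + 2 * a * ⟪m.B m.v, x⟫ + ⟪x, m.B x⟫ := by
    have := (abs_le.1 h3).1
    linarith
  have h6 := mul_le_mul_of_nonneg_left h5 (by positivity : 0 ≤ β * T ^ 2)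
  have h7 : β * T ^ 2 * ((2 * M ^ 2 / b + M') * ‖x‖ ^ 2) ≤ γ / 2 * ‖x‖ ^ 2 := by
    have : β * T ^ 2 * (2 * M ^ 2 / b + M') ≤ γ / 2 := by
      have h9 : β * T ^ 2 * (2 * M ^ 2 / b + M') ≤ T ^ 2 * D := by
        rw [hD]; linarith [sq_nonneg T]
      have h10 : T ^ 2 * D ≤ T * D := by
        apply mul_le_mul_of_nonneg_right _ hD0.le; nlinarith
      linarith
    have h11 := mul_le_mul_of_nonneg_right this (sq_nonneg ‖x‖)
    linarith
  have h8 : min (β * b / 2) (γ / 2) * (T ^ 2 * a ^ 2) ≤ β * b / 2 * (T ^ 2 * a ^ 2) :=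
    mul_le_mul_of_nonneg_right (min_le_left _ _) (by positivity)
  have h9 : min (β * b / 2) (γ / 2) * ‖x‖ ^ 2 ≤ γ / 2 * ‖x‖ ^ 2 :=
    mul_le_mul_of_nonneg_right (min_le_right _ _) (by positivity)
  linarith

theorem v_ne_zero : m.v ≠ 0 := by
  intro h
  have := m.B_pos
  simp [h] at this

theorem exists_decomposition (x : H) : ∃ (a : ℝ) (y : H), ⟪m.v, y⟫ = 0 ∧ x = a • m.v + y := by
  refine ⟨⟪m.v, x⟫ / ‖m.v‖ ^ 2, x - (⟪m.v, x⟫ / ‖m.v‖ ^ 2) • m.v, ?_, by abel⟩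
  have : ‖m.v‖ ^ 2 ≠ 0 := pow_ne_zero _ (norm_ne_zero_iff.2 m.v_ne_zero)
  rw [inner_sub_right, inner_smul_right, real_inner_self_eq_norm_sq, div_mul_cancel₀ _ this,
    sub_self]

/-- Bijectivity of a coercive pencil. -/
theorem pencil_bijective [CompleteSpace H] {α β κ T : ℝ} (hκ : 0 < κ) (hT : 0 < T)
    (hco : ∀ (a : ℝ) (x : H), ⟪m.v, x⟫ = 0 →
      κ * (T ^ 2 * a ^ 2 + ‖x‖ ^ 2) ≤ ⟪a • m.v + x, m.pencil α β T (a • m.v + x)⟫) :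
    Function.Bijective (m.pencil α β T) := by
  set L := m.pencil α β T
  have hv : 0 < ‖m.v‖ := norm_pos_iff.2 m.v_ne_zero
  -- Lax–Milgram: the constant degenerates as T → 0 but is positive for each fixed T.
  have hc : IsCoercive ((innerSL ℝ).comp L) := by
    refine ⟨κ * min (T ^ 2 / ‖m.v‖ ^ 2) 1, by positivity, fun u => ?_⟩
    obtain ⟨a, x, hx, rfl⟩ := m.exists_decomposition u
    have h1 := hco a x hx
    have h2 : ‖a • m.v + x‖ * ‖a • m.v + x‖ = a ^ 2 * ‖m.v‖ ^ 2 + ‖x‖ ^ 2 := by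
      rw [norm_add_sq_eq_norm_sq_add_norm_sq_of_inner_eq_zero _ _
        (by rw [inner_smul_left, hx, mul_zero]), norm_smul, Real.norm_eq_abs]
      nlinarith [sq_abs a]
    rw [mul_assoc, mul_assoc, ContinuousLinearMap.comp_apply, innerSL_apply_apply,
      real_inner_comm, h2]
    refine le_trans (mul_le_mul_of_nonneg_left ?_ hκ.le) h1
    have h3 : min (T ^ 2 / ‖m.v‖ ^ 2) 1 * (a ^ 2 * ‖m.v‖ ^ 2) ≤ T ^ 2 * a ^ 2 := by
      refine (mul_le_mul_of_nonneg_right (min_le_left _ _) (by positivity)).trans_eq ?_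
      field_simp
    have h4 : min (T ^ 2 / ‖m.v‖ ^ 2) 1 * ‖x‖ ^ 2 ≤ 1 * ‖x‖ ^ 2 :=
      mul_le_mul_of_nonneg_right (min_le_right _ _) (by positivity)
    linarith
  have hL : ∀ u, hc.continuousLinearEquivOfBilin u = L u := by
    intro u
    refine ext_inner_right ℝ fun w => ?_
    rw [hc.continuousLinearEquivOfBilin_apply]
    simp
  have : (L : H → H) = hc.continuousLinearEquivOfBilin := funext fun u => (hL u).symm
  rw [this]
  exact hc.continuousLinearEquivOfBilin.bijective

/-- A priori estimate for the pencil with a right-hand side whose main part is orthogonal to `v`. -/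
theorem pencil_estimate {α β κ T R a : ℝ} {x r₁ r₂ : H} (hκ : 0 < κ) (hT : 0 < T) (hT1 : T < 1)
    (hR : 0 ≤ R) (hr₁ : ⟪m.v, r₁⟫ = 0) (hr₁n : ‖r₁‖ ≤ R) (hr₂n : ‖r₂‖ ≤ R * T)
    (hco : κ * (T ^ 2 * a ^ 2 + ‖x‖ ^ 2) ≤ ⟪a • m.v + x, m.pencil α β T (a • m.v + x)⟫)
    (heq : m.pencil α β T (a • m.v + x) = r₁ + r₂) :
    T * |a| + ‖x‖ ≤ 2 * (2 + ‖m.v‖) / κ * R := by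
  set n := T * |a| + ‖x‖ with hn
  have hn0 : 0 ≤ n := by positivity
  have hv := norm_nonneg m.v
  have hx := norm_nonneg x
  have ha := abs_nonneg a
  -- Coercivity controls only T|a|. The pairing of a v with r₁ vanishes by orthogonality, and its
  -- pairing with r₂ gains the missing T from the bound on r₂.
  rw [heq, inner_add_right, inner_add_left, inner_smul_left, hr₁, mul_zero, zero_add] at hco
  have h1 : ⟪x, r₁⟫ ≤ ‖x‖ * R :=
    (real_inner_le_norm _ _).trans (mul_le_mul_of_nonneg_left hr₁n hx)
  have h2 : ⟪a • m.v + x, r₂⟫ ≤ (|a| * ‖m.v‖ + ‖x‖) * (R * T) := by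
    refine (real_inner_le_norm _ _).trans (mul_le_mul ?_ hr₂n (norm_nonneg _) (by positivity))
    refine (norm_add_le _ _).trans_eq ?_
    rw [norm_smul, Real.norm_eq_abs]
  have h3 : (|a| * ‖m.v‖ + ‖x‖) * (R * T) + ‖x‖ * R ≤ R * (2 + ‖m.v‖) * n := by
    have h4 : R * (2 + ‖m.v‖) * n - ((|a| * ‖m.v‖ + ‖x‖) * (R * T) + ‖x‖ * R) =
        R * (2 * (T * |a|) + ‖m.v‖ * ‖x‖ + (1 - T) * ‖x‖) := by rw [hn]; ring
    have h5 : 0 ≤ R * (2 * (T * |a|) + ‖m.v‖ * ‖x‖ + (1 - T) * ‖x‖) := by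
      have : 0 ≤ 1 - T := by linarith
      positivity
    linarith
  have h4 : n ^ 2 / 2 ≤ T ^ 2 * a ^ 2 + ‖x‖ ^ 2 := by
    have : T ^ 2 * a ^ 2 + ‖x‖ ^ 2 - n ^ 2 / 2 = (T * |a| - ‖x‖) ^ 2 / 2 := by
      rw [← sq_abs a, hn]; ring
    nlinarith [sq_nonneg (T * |a| - ‖x‖)]
  have h5 : κ * (n ^ 2 / 2) ≤ R * (2 + ‖m.v‖) * n :=
    (mul_le_mul_of_nonneg_left h4 hκ.le).trans (by linarith)
  rcases hn0.eq_or_lt with h0 | h0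
  · rw [← h0]; positivity
  · have h6 : κ * n ≤ 2 * (R * (2 + ‖m.v‖)) := by
      by_contra! h
      have := mul_lt_mul_of_pos_right h h0
      linarith
    rw [div_mul_eq_mul_div, le_div_iff₀ hκ]
    linarith

theorem norm_half_add_le (x : H) : ‖(1 / 2 : ℝ) • (x + m.N x)‖ ≤ ‖x‖ := by
  rw [norm_smul]
  have := norm_add_le x (m.N x)
  rw [m.norm_N] at this
  norm_num
  linarith

theorem norm_half_sub_le (x : H) : ‖(1 / 2 : ℝ) • (x - m.N x)‖ ≤ ‖x‖ := by
  rw [norm_smul]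
  have := norm_sub_le x (m.N x)
  rw [m.norm_N] at this
  norm_num
  linarith

/-- The leading coefficient of the solution of the pencil equation. -/
def leadingCoeff (α β Ω : ℝ) : ℝ :=
  Ω * ⟪m.v, m.q⟫ / (β * ⟪m.v, m.B m.v⟫ - α ^ 2 * ⟪m.v, m.A (m.neumann (m.A m.v))⟫)

/-- With o the Neumann sum of Av, antisymmetry gives -⟨v,Ao⟩ = ⟨Av,o⟩ = ⟨o - Ko,o⟩ ≥ 0, so the
second term cannot cancel the first. -/
theorem leadingCoeff_denom_pos [CompleteSpace H] (α : ℝ) {β : ℝ} (hβ : 0 < β) :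
    0 < β * ⟪m.v, m.B m.v⟫ - α ^ 2 * ⟪m.v, m.A (m.neumann (m.A m.v))⟫ := by
  have ho := m.inner_v_of_odd m.N_A_v
  have h1 : ⟪m.v, m.A (m.neumann (m.A m.v))⟫ ≤ 0 := by
    have h2 := m.A_antisymm m.v (m.neumann (m.A m.v))
    have h3 := m.coercive_on_orthogonal _ (m.inner_v_neumann _ ho)
    rw [m.neumann_sub _ ho, real_inner_comm] at h3
    have h4 : 0 ≤ (1 - m.ρ) * ‖m.neumann (m.A m.v)‖ ^ 2 :=
      mul_nonneg (by linarith [m.ρ_lt_one]) (by positivity)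
    linarith
  have h5 := mul_pos hβ m.B_pos
  have h6 := mul_nonneg (sq_nonneg α) (neg_nonneg.2 h1)
  linarith

theorem leadingCoeff_pos [CompleteSpace H] (α : ℝ) {β Ω : ℝ} (hβ : 0 < β) (hΩ : 0 < Ω) :
    0 < m.leadingCoeff α β Ω :=
  div_pos (mul_pos hΩ m.q_pos) (m.leadingCoeff_denom_pos α hβ)

/-- The second-order even correction. -/
theorem exists_even_correction [CompleteSpace H] (α : ℝ) {β Ω : ℝ} (hβ : 0 < β) (hΩ : 0 < Ω) :
    ∃ e, m.N e = e ∧ e - m.K e = (Ω / m.leadingCoeff α β Ω) • m.q +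
      α ^ 2 • m.A (m.neumann (m.A m.v)) - β • m.B m.v := by
  set o := m.neumann (m.A m.v) with ho
  have hoo : m.N o = -o := m.N_neumann_odd _ (m.inner_v_of_odd m.N_A_v) m.N_A_v
  set f := (Ω / m.leadingCoeff α β Ω) • m.q + α ^ 2 • m.A o - β • m.B m.v with hf
  -- The solvability condition for e - Ke = f; it is the equation that `leadingCoeff` solves.
  have hfv : ⟪m.v, f⟫ = 0 := by
    have hq := m.q_pos.ne'
    have hd := (m.leadingCoeff_denom_pos α hβ).ne'
    rw [hf, inner_sub_right, inner_add_right, inner_smul_right, inner_smul_right, inner_smul_right,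
      leadingCoeff, ← ho]
    rw [← ho] at hd
    field_simp
    ring
  have hfN : m.N f = f := by
    rw [hf, map_sub, map_add, map_smul, map_smul, map_smul, m.N_q, m.N_A, m.N_B, m.N_v, hoo,
      map_neg, neg_neg]
  exact ⟨m.neumann f, m.N_neumann_even f hfv hfN, m.neumann_sub f hfv⟩

/-- Low-temperature behaviour of the solution of the pencil equation. -/
theorem low_temperature_asymptotics [CompleteSpace H] (α : ℝ) {β Ω : ℝ} (hβ : 0 < β) (hΩ : 0 < Ω) :
    ∃ T₀ M : ℝ, 0 < T₀ ∧ ∀ T, 0 < T → T < T₀ →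
      Function.Bijective (m.pencil α β T) ∧
      ∀ x, m.pencil α β T x = (Ω / T ^ 3) • m.q →
        ‖(1 / 2 : ℝ) • (x + m.N x) - (m.leadingCoeff α β Ω / T ^ 5) • m.v‖ ≤ M / T ^ 3 ∧
        ‖(1 / 2 : ℝ) • (x - m.N x) -
          (m.leadingCoeff α β Ω / T ^ 5 * (α * T)) • m.neumann (m.A m.v)‖ ≤ M / T ^ 2 := by
  obtain ⟨κ, T₁, hκ, hT₁, hco⟩ := m.pencil_coercive (α := α) hβ
  obtain ⟨e, heN, he⟩ := m.exists_even_correction α hβ hΩ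
  set C := m.leadingCoeff α β Ω with hC
  have hC0 : 0 < C := m.leadingCoeff_pos α hβ hΩ
  have hAv := m.inner_v_of_odd m.N_A_v
  have ho := m.neumann_sub _ hAv
  have hoN := m.N_neumann_odd _ hAv m.N_A_v
  set o := m.neumann (m.A m.v) with hodef
  -- `s₁` and `s₂` are the coefficients of T³ and T⁴ left over when the expansion stops at T².
  set s₁ := (α * β) • m.B o - α • m.A e with hs₁
  set s₂ := β • m.B e with hs₂
  -- B preserves the oddness of o and A reverses the evenness of e, so the main residual is odd.
  have hs₁v : ⟪m.v, s₁⟫ = 0 := by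
    apply m.inner_v_of_odd
    rw [hs₁, map_sub, map_smul, map_smul, m.N_B, m.N_A, hoN, heN, map_neg]
    module
  set R₀ := C * (‖s₁‖ + ‖s₂‖) with hR₀
  have hR₀0 : 0 ≤ R₀ := by positivity
  set D := 2 * (2 + ‖m.v‖) / κ * R₀ with hD
  have hD0 : 0 ≤ D := by positivity
  refine ⟨min T₁ 1, D * (‖m.v‖ + 1) + C * ‖e‖, by positivity, ?_⟩
  intro T hT hTT
  have hT1 : T < 1 := hTT.trans_le (min_le_right _ _)
  have hcoT := hco T hT (hTT.trans_le (min_le_left _ _))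
  refine ⟨m.pencil_bijective hκ hT hcoT, ?_⟩
  intro x hx
  set c := C / T ^ 5 with hc
  have hc0 : 0 < c := by positivity
  -- The power T⁻⁵ in c makes the T² term of the expansion match the source Ω/T³.
  set y := c • (m.v + (α * T) • o + T ^ 2 • e) with hy
  have hpy : m.pencil α β T y = (Ω / T ^ 3) • m.q + (c * T ^ 3) • s₁ + (c * T ^ 4) • s₂ := by
    have h1 : m.pencil α β T y = c • ((m.v - m.K m.v) + (α * T) • ((o - m.K o) - m.A m.v)
        + T ^ 2 • (e - m.K e - (α ^ 2 • m.A o - β • m.B m.v)) + T ^ 3 • s₁ + T ^ 4 • s₂) := by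
      rw [hy, pencil_apply, hs₁, hs₂]
      simp only [map_add, map_smul]
      module
    have h2 : Ω / T ^ 3 = c * (T ^ 2 * (Ω / C)) := by
      rw [hc]; field_simp
    rw [h1, m.K_v, ho, he, h2]
    module
  obtain ⟨a, d, hd, had⟩ := m.exists_decomposition (x - y)
  have hxy : x = y + (a • m.v + d) := by rw [← had]; abel
  have hpd : m.pencil α β T (a • m.v + d) = -((c * T ^ 3) • s₁) + -((c * T ^ 4) • s₂) := by
    rw [← had, map_sub, hx, hpy]
    abel
  have hcT : C * T⁻¹ ^ 2 = c * T ^ 3 := by rw [hc]; field_simp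
  -- The residual has size cT³ = C T⁻², and its smaller part carries one further T.
  have hest : T * |a| + ‖d‖ ≤ D * T⁻¹ ^ 2 := by
    have h := m.pencil_estimate (R := R₀ * T⁻¹ ^ 2) hκ hT hT1 (by positivity)
      (r₁ := -((c * T ^ 3) • s₁)) (r₂ := -((c * T ^ 4) • s₂))
      (by rw [inner_neg_right, inner_smul_right, hs₁v, mul_zero, neg_zero]) ?_ ?_ (hcoT a d hd) hpd
    · rw [hD]; linarith
    · rw [norm_neg, norm_smul, Real.norm_of_nonneg (by positivity), hR₀, ← hcT]
      have : 0 ≤ C * T⁻¹ ^ 2 * ‖s₂‖ := by positivity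
      linarith
    · rw [norm_neg, norm_smul, Real.norm_of_nonneg (by positivity), hR₀,
        show c * T ^ 4 = C * T⁻¹ ^ 2 * T by rw [hcT]; ring]
      have : 0 ≤ C * T⁻¹ ^ 2 * T * ‖s₁‖ := by positivity
      linarith
  have hdn : ‖d‖ ≤ D / T ^ 2 := by
    have : 0 ≤ T * |a| := by positivity
    rw [div_eq_mul_inv, ← inv_pow]; linarith
  have han : |a| ≤ D / T ^ 3 := by
    have h1 : T * |a| ≤ D * T⁻¹ ^ 2 := by linarith [norm_nonneg d]
    rw [le_div_iff₀ (by positivity)]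
    calc |a| * T ^ 3 = T * |a| * T ^ 2 := by ring
      _ ≤ D * T⁻¹ ^ 2 * T ^ 2 := mul_le_mul_of_nonneg_right h1 (by positivity)
      _ = D := by field_simp
  have hdn3 : ‖d‖ ≤ D / T ^ 3 :=
    hdn.trans (div_le_div_of_nonneg_left hD0 (by positivity)
      (pow_le_pow_of_le_one hT.le hT1.le (by norm_num)))
  constructor
  · have h1 : (1 / 2 : ℝ) • (x + m.N x) - c • m.v =
        (c * T ^ 2) • e + (1 / 2 : ℝ) • ((a • m.v + d) + m.N (a • m.v + d)) := by
      rw [hxy, map_add m.N y, hy, map_smul, map_add, map_add, map_smul, map_smul, m.N_v, hoN, heN]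
      module
    rw [h1]
    have h2 : ‖a • m.v + d‖ ≤ D / T ^ 3 * ‖m.v‖ + D / T ^ 3 := by
      refine (norm_add_le _ _).trans (add_le_add ?_ hdn3)
      rw [norm_smul, Real.norm_eq_abs]
      exact mul_le_mul_of_nonneg_right han (norm_nonneg _)
    have h3 : ‖(c * T ^ 2) • e‖ = C / T ^ 3 * ‖e‖ := by
      rw [norm_smul, Real.norm_of_nonneg (by positivity), hc]
      congr 1
      field_simp
    refine (norm_add_le _ _).trans ?_
    rw [h3]
    have h4 := (m.norm_half_add_le (a • m.v + d)).trans h2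
    calc C / T ^ 3 * ‖e‖ + ‖(1 / 2 : ℝ) • (a • m.v + d + m.N (a • m.v + d))‖
        ≤ C / T ^ 3 * ‖e‖ + (D / T ^ 3 * ‖m.v‖ + D / T ^ 3) := by linarith
      _ = (D * (‖m.v‖ + 1) + C * ‖e‖) / T ^ 3 := by ring
  · have h1 : (1 / 2 : ℝ) • (x - m.N x) - (c * (α * T)) • o = (1 / 2 : ℝ) • (d - m.N d) := by
      rw [hxy, map_add m.N y, map_add m.N (a • m.v), hy, map_smul, map_smul, map_add, map_add,
        map_smul, map_smul, m.N_v, hoN, heN]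
      module
    rw [h1]
    refine (m.norm_half_sub_le d).trans (hdn.trans ?_)
    apply div_le_div_of_nonneg_right _ (by positivity)
    have h2 : 0 ≤ D * ‖m.v‖ := by positivity
    have h3 : 0 ≤ C * ‖e‖ := by positivity
    linarith

end LowTemperatureModel

/-! ### Compactness of operators with square integrable kernel -/

theorem norm_sq_Lp_eq_integral {X : Type*} [MeasurableSpace X] {μ : Measure X} (f : Lp ℝ 2 μ) :
    ‖f‖ ^ 2 = ∫ x, f x ^ 2 ∂μ := by
  rw [← real_inner_self_eq_norm_sq, L2.inner_def]
  simp [sq]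

/-- A Hilbert–Schmidt type criterion for compactness. -/
theorem isCompactOperator_of_summable_norm_sq {H E ι : Type*} [NormedAddCommGroup H]
    [InnerProductSpace ℝ H] [NormedAddCommGroup E] [NormedSpace ℝ E] [CompleteSpace E]
    (Op : H →L[ℝ] E) (b : HilbertBasis ι ℝ H) (hs : Summable fun i => ‖Op (b i)‖ ^ 2) :
    IsCompactOperator Op := by
  classical
  let fin : Finset ι → H →L[ℝ] E := fun F => ∑ i ∈ F, (innerSL ℝ (b i)).smulRight (Op (b i))
  have hfin : ∀ F, IsCompactOperator (fin F) := by
    intro F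
    have : fin F ∈ compactOperator (RingHom.id ℝ) H E := by
      refine Submodule.sum_mem _ fun i _ => ?_
      have h1 : IsCompactOperator (innerSL ℝ (b i)) :=
        isCompactOperator_of_locallyCompactSpace_dom _
      exact h1.clm_comp ((ContinuousLinearMap.id ℝ ℝ).smulRight (Op (b i)))
    exact this
  refine isCompactOperator_of_tendsto (l := atTop) (F := fin) ?_ (Eventually.of_forall hfin)
  rw [Metric.tendsto_atTop]
  intro ε hε
  -- Finite-rank truncations converge in operator norm: Cauchy–Schwarz bounds a tail by the tail of
  -- Σ‖Op bᵢ‖² times the Bessel bound ‖φ‖².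
  obtain ⟨F₀, hF₀⟩ := summable_iff_vanishing_norm.1 hs ((ε / 2) ^ 2) (by positivity)
  refine ⟨F₀, fun F hF => ?_⟩
  rw [dist_eq_norm]
  refine lt_of_le_of_lt (b := ε / 2) ?_ (by linarith)
  refine ContinuousLinearMap.opNorm_le_bound _ (by positivity) fun φ => ?_
  have hsum : HasSum (fun i => ⟪b i, φ⟫ • Op (b i)) (Op φ) := by
    have := (b.hasSum_repr φ).mapL Op
    simpa [b.repr_apply_apply] using this
  have hlim : Tendsto (fun F' : Finset ι => ‖fin F φ - ∑ i ∈ F', ⟪b i, φ⟫ • Op (b i)‖) atTop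
      (𝓝 ‖fin F φ - Op φ‖) := (tendsto_const_nhds.sub hsum).norm
  refine le_of_tendsto hlim ?_
  filter_upwards [eventually_ge_atTop F] with F' hF'
  have h1 : fin F φ - ∑ i ∈ F', ⟪b i, φ⟫ • Op (b i) =
      -∑ i ∈ F' \ F, ⟪b i, φ⟫ • Op (b i) := by
    rw [← Finset.sum_sdiff hF']
    simp [fin]
  rw [h1, norm_neg]
  have h2 : ∑ i ∈ F' \ F, ‖Op (b i)‖ ^ 2 ≤ (ε / 2) ^ 2 := by
    have := hF₀ (F' \ F) (Finset.disjoint_left.2 fun i hi hi' =>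
      (Finset.mem_sdiff.1 hi).2 (hF hi'))
    exact (le_abs_self _).trans this.le
  have h3 : ∑ i ∈ F' \ F, ‖⟪b i, φ⟫‖ ^ 2 ≤ ‖φ‖ ^ 2 := b.orthonormal.sum_inner_products_le φ
  have h4 := Finset.sum_mul_sq_le_sq_mul_sq (F' \ F) (fun i => ‖⟪b i, φ⟫‖) (fun i => ‖Op (b i)‖)
  have h5 : ‖∑ i ∈ F' \ F, ⟪b i, φ⟫ • Op (b i)‖ ≤ ∑ i ∈ F' \ F, ‖⟪b i, φ⟫‖ * ‖Op (b i)‖ :=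
    norm_sum_le_of_le _ fun i _ => (norm_smul _ _).le
  refine h5.trans (abs_le_of_sq_le_sq' ?_ (by positivity)).2
  refine h4.trans ?_
  rw [mul_pow, mul_comm]
  exact mul_le_mul h2 h3 (Finset.sum_nonneg fun _ _ => by positivity) (by positivity)

/-- The Carleman operator `φ ↦ (x ↦ ⟪k x, φ⟫)` with square integrable `‖k x‖` is compact. -/
theorem exists_compact_carleman {X H : Type*} [MeasurableSpace X] {μ : Measure X}
    [NormedAddCommGroup H] [InnerProductSpace ℝ H] [CompleteSpace H] (k : X → H) (G : X → ℝ)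
    (hG : Integrable G μ) (hk : ∀ φ : H, AEStronglyMeasurable (fun x => ⟪k x, φ⟫) μ)
    (hkG : ∀ x, ‖k x‖ ^ 2 ≤ G x) :
    ∃ Op : H →L[ℝ] Lp ℝ 2 μ, IsCompactOperator Op ∧
      ∀ φ : H, Op φ =ᵐ[μ] fun x => ⟪k x, φ⟫ := by
  have hle : ∀ (φ : H) (x : X), ⟪k x, φ⟫ ^ 2 ≤ G x * ‖φ‖ ^ 2 := by
    intro φ x
    have h1 := abs_real_inner_le_norm (k x) φ
    calc ⟪k x, φ⟫ ^ 2 = |⟪k x, φ⟫| ^ 2 := (sq_abs _).symm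
      _ ≤ (‖k x‖ * ‖φ‖) ^ 2 := by gcongr
      _ = ‖k x‖ ^ 2 * ‖φ‖ ^ 2 := mul_pow _ _ _
      _ ≤ G x * ‖φ‖ ^ 2 := mul_le_mul_of_nonneg_right (hkG x) (by positivity)
  have hkint : ∀ φ : H, Integrable (fun x => ⟪k x, φ⟫ ^ 2) μ := fun φ =>
    (hG.mul_const _).mono' ((hk φ).pow 2) (Eventually.of_forall fun x => by
      rw [Real.norm_of_nonneg (sq_nonneg _)]; exact hle φ x)
  have hmem : ∀ φ : H, MemLp (fun x => ⟪k x, φ⟫) 2 μ := fun φ =>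
    (memLp_two_iff_integrable_sq (hk φ)).2 (hkint φ)
  let lin : H →ₗ[ℝ] Lp ℝ 2 μ :=
    { toFun := fun φ => (hmem φ).toLp _
      map_add' := fun φ ψ => by
        rw [← MemLp.toLp_add]
        exact MemLp.toLp_congr _ _ (Eventually.of_forall fun x => inner_add_right _ _ _)
      map_smul' := fun c φ => by
        rw [RingHom.id_apply, ← MemLp.toLp_const_smul]
        exact MemLp.toLp_congr _ _ (Eventually.of_forall fun x => inner_smul_right _ _ _) }
  have hlin : ∀ φ, lin φ =ᵐ[μ] fun x => ⟪k x, φ⟫ := fun φ => MemLp.coeFn_toLp (hmem φ)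
  have hsq : ∀ φ, ‖lin φ‖ ^ 2 = ∫ x, ⟪k x, φ⟫ ^ 2 ∂μ := fun φ => by
    rw [norm_sq_Lp_eq_integral]
    exact integral_congr_ae ((hlin φ).mono fun x hx => by simp only [hx])
  have hG0 : 0 ≤ ∫ x, G x ∂μ := integral_nonneg fun x => (sq_nonneg _).trans (hkG x)
  have hbound : ∀ φ, ‖lin φ‖ ≤ √(∫ x, G x ∂μ) * ‖φ‖ := fun φ => by
    refine (abs_le_of_sq_le_sq' ?_ (by positivity)).2
    rw [hsq, mul_pow, Real.sq_sqrt hG0, ← integral_mul_const]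
    exact integral_mono (hkint φ) (hG.mul_const _) (hle φ)
  refine ⟨lin.mkContinuous _ hbound, ?_, hlin⟩
  obtain ⟨w, b, -⟩ := exists_hilbertBasis ℝ H
  refine isCompactOperator_of_summable_norm_sq _ b ?_
  -- Bessel's inequality for k x at each x, then integrated, bounds all finite sums by ∫ G.
  refine summable_of_sum_le (c := ∫ x, G x ∂μ) (fun i => by positivity) fun F => ?_
  simp only [LinearMap.mkContinuous_apply, hsq]
  rw [← integral_finsetSum _ fun i _ => hkint (b i)]
  refine integral_mono (integrable_finsetSum _ fun i _ => hkint (b i)) hG fun x => ?_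
  refine le_trans ?_ (hkG x)
  refine le_trans (le_of_eq ?_) (b.orthonormal.sum_inner_products_le (s := F) (k x))
  refine Finset.sum_congr rfl fun i _ => ?_
  rw [Real.norm_eq_abs, sq_abs, real_inner_comm]

/-! ### Hyperbolic form of the kernel and bounds on the rate -/

/-- The phonon spectrum `y² / |sinh (y/2)|`. -/
def phononSpectrum (y : ℝ) : ℝ := y ^ 2 / |Real.sinh (y / 2)|

/-- The dimensionless rate `g(x) = ∫ dy k̄₀(x, y)`. -/
def rate (x : ℝ) : ℝ := ∫ y, kbar x y

theorem bose_add_fermi {x y : ℝ} (hy : y ≠ 0) :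
    bose y + fermi (y + x) =
      Real.cosh (x / 2) / Real.cosh ((x + y) / 2) / (2 * Real.sinh (y / 2)) := by
  set a := Real.exp (x / 2) with ha
  set b := Real.exp (y / 2) with hb
  have ha0 : 0 < a := Real.exp_pos _
  have hb0 : 0 < b := Real.exp_pos _
  have hx : Real.exp x = a ^ 2 := by rw [ha, ← Real.exp_nat_mul]; congr 1; push_cast; ring
  have hyb : Real.exp y = b ^ 2 := by rw [hb, ← Real.exp_nat_mul]; congr 1; push_cast; ring
  have hb1 : b ^ 2 - 1 ≠ 0 := by
    rw [← hyb, sub_ne_zero]; simpa using hy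
  have hxy : Real.exp ((x + y) / 2) = a * b := by
    rw [ha, hb, ← Real.exp_add]; congr 1; ring
  have hc : a ^ 2 * b ^ 2 + 1 ≠ 0 := by positivity
  rw [bose, fermi, Real.cosh_eq, Real.cosh_eq, Real.sinh_eq, Real.exp_neg, Real.exp_neg,
    Real.exp_neg, Real.exp_add, hx, hyb, hxy, ← ha, ← hb]
  have h1 : b - b⁻¹ = (b ^ 2 - 1) / b := by field_simp
  have h2 : a * b + (a * b)⁻¹ = (a ^ 2 * b ^ 2 + 1) / (a * b) := by field_simp
  have h3 : a + a⁻¹ = (a ^ 2 + 1) / a := by field_simp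
  rw [h1, h2, h3, mul_comm (b ^ 2) (a ^ 2)]
  field_simp
  ring

/-- Detailed balance: with z = x + y the only asymmetric factor is cosh(x/2)/cosh(z/2), which
conjugation by √w ∝ 1/cosh(x/2) removes. -/
theorem kbar_eq (x y : ℝ) :
    kbar x y = Real.cosh (x / 2) / Real.cosh ((x + y) / 2) * (phononSpectrum y / 2) := by
  -- At y = 0 both sides are 0, the right one because the numerator y² vanishes.
  rcases eq_or_ne y 0 with rfl | hy
  · simp [kbar, phononSpectrum]
  rw [kbar, bose_add_fermi hy, phononSpectrum]
  rcases lt_or_gt_of_ne hy with h | h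
  · have hs : Real.sinh (y / 2) < 0 := Real.sinh_neg_iff.2 (by linarith)
    rw [Real.sign_of_neg h, abs_of_neg hs]
    have := hs.ne
    field_simp
  · have hs : 0 < Real.sinh (y / 2) := Real.sinh_pos_iff.2 (by linarith)
    rw [Real.sign_of_pos h, abs_of_pos hs]
    field_simp

theorem weight_eq (T ε : ℝ) : weight T ε = 1 / (4 * Real.cosh (ε / T / 2) ^ 2) := by
  set x := ε / T with hx
  set a := Real.exp (x / 2) with ha
  have ha0 : 0 < a := Real.exp_pos _
  have hxa : Real.exp x = a ^ 2 := by rw [ha, ← Real.exp_nat_mul]; congr 1; push_cast; ring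
  rw [weight, fermi, Real.cosh_eq, Real.exp_neg, ← hx, hxa, ← ha]
  have h3 : a + a⁻¹ = (a ^ 2 + 1) / a := by field_simp
  rw [h3]
  field_simp
  ring

theorem phononSpectrum_nonneg (y : ℝ) : 0 ≤ phononSpectrum y := by unfold phononSpectrum; positivity

theorem phononSpectrum_pos {y : ℝ} (hy : y ≠ 0) : 0 < phononSpectrum y := by
  have : Real.sinh (y / 2) ≠ 0 := by simpa [Real.sinh_eq_zero] using hy
  unfold phononSpectrum; positivity

theorem phononSpectrum_neg (y : ℝ) : phononSpectrum (-y) = phononSpectrum y := by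
  simp [phononSpectrum, neg_div, Real.sinh_neg]

theorem measurable_phononSpectrum : Measurable phononSpectrum := by
  unfold phononSpectrum
  exact (measurable_id.pow_const 2).div
    ((Real.measurable_sinh.comp (measurable_id.div_const 2)).abs)

theorem pow_le_factorial_mul_exp {t : ℝ} (ht : 0 ≤ t) (n : ℕ) :
    t ^ n ≤ n.factorial * Real.exp t := by
  have := Real.pow_div_factorial_le_exp t ht n
  rw [div_le_iff₀ (by positivity)] at this
  linarith

theorem exists_phononSpectrum_bound : ∃ C : ℝ, 0 < C ∧ ∀ y, phononSpectrum y * (1 + y ^ 2) ^ 2 ≤ C := by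
  -- With |y| = 4t, y²(1+y²)² = t(16t + 512t³ + 4096t⁵). Each tⁿ is at most n! eᵗ, and sinh 2t ≥ t
  -- eᵗ.
  refine ⟨16 + 512 * 6 + 4096 * 120, by norm_num, fun y => ?_⟩
  rcases eq_or_ne y 0 with rfl | hy
  · simp [phononSpectrum]; norm_num
  have ht : 0 < |y| / 4 := by positivity
  set t := |y| / 4 with htdef
  have hy4 : |y| = 4 * t := by rw [htdef]; ring
  have hs : t * Real.exp t ≤ |Real.sinh (y / 2)| := by
    have h1 : |Real.sinh (y / 2)| = Real.sinh (2 * t) := by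
      rw [Real.abs_sinh, abs_div, hy4]; congr 1; norm_num; ring
    rw [h1, Real.sinh_two_mul]
    have h2 : t ≤ Real.sinh t := Real.self_le_sinh_iff.2 ht.le
    have h3 : Real.exp t / 2 ≤ Real.cosh t := by
      rw [Real.cosh_eq]; linarith [Real.exp_pos (-t)]
    have := mul_le_mul h2 h3 (by positivity) (by linarith)
    linarith
  have hpos : 0 < t * Real.exp t := by positivity
  rw [phononSpectrum, ← sq_abs y, hy4, div_mul_eq_mul_div, div_le_iff₀ (hpos.trans_le hs)]
  refine le_trans ?_ (mul_le_mul_of_nonneg_left hs (by norm_num))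
  have e1 := pow_le_factorial_mul_exp ht.le 1
  have e3 := pow_le_factorial_mul_exp ht.le 3
  have e5 := pow_le_factorial_mul_exp ht.le 5
  norm_num [Nat.factorial] at e1 e3 e5
  have : t * (16 * t + 512 * t ^ 3 + 4096 * t ^ 5) ≤
      t * ((16 + 512 * 6 + 4096 * 120) * Real.exp t) :=
    mul_le_mul_of_nonneg_left (by linarith) ht.le
  linarith

/-- Profiles dominated by `1 / (1 + y²)`. -/
structure IsProfile (j : ℝ → ℝ) : Prop where
  measurable : Measurable j
  bound : ∃ C : ℝ, 0 < C ∧ ∀ y, |j y| ≤ C * (1 + y ^ 2)⁻¹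

theorem IsProfile.integrable {j : ℝ → ℝ} (hj : IsProfile j) : Integrable j := by
  obtain ⟨C, -, hC⟩ := hj.bound
  exact (integrable_inv_one_add_sq.const_mul C).mono' hj.measurable.aestronglyMeasurable
    (Eventually.of_forall hC)

theorem IsProfile.integrable_sq {j : ℝ → ℝ} (hj : IsProfile j) : Integrable fun y => j y ^ 2 := by
  obtain ⟨C, hC0, hC⟩ := hj.bound
  refine (integrable_inv_one_add_sq.const_mul (C ^ 2)).mono'
    (hj.measurable.pow_const 2).aestronglyMeasurable (Eventually.of_forall fun y => ?_)
  have h1 : (1 + y ^ 2)⁻¹ ≤ 1 := inv_le_one_of_one_le₀ (by nlinarith)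
  have h0 : 0 < (1 + y ^ 2)⁻¹ := by positivity
  rw [Real.norm_of_nonneg (sq_nonneg _), ← sq_abs]
  calc |j y| ^ 2 ≤ (C * (1 + y ^ 2)⁻¹) ^ 2 := by gcongr; exact hC y
    _ = C ^ 2 * ((1 + y ^ 2)⁻¹ * (1 + y ^ 2)⁻¹) := by ring
    _ ≤ C ^ 2 * ((1 + y ^ 2)⁻¹ * 1) := by gcongr
    _ = C ^ 2 * (1 + y ^ 2)⁻¹ := by ring

/-- The spectrum is O((1+y²)⁻²), so a factor up to 1 + y² may be spent. This covers the factors 1,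
y, y² of the three kernels. -/
theorem isProfile_mul_phononSpectrum {η : ℝ → ℝ} (hη : Measurable η) (hb : ∀ y, |η y| ≤ 1 + y ^ 2) :
    IsProfile fun y => η y * phononSpectrum y := by
  refine ⟨hη.mul measurable_phononSpectrum, ?_⟩
  obtain ⟨C, hC0, hC⟩ := exists_phononSpectrum_bound
  refine ⟨C, hC0, fun y => ?_⟩
  have h0 : 0 < 1 + y ^ 2 := by positivity
  rw [abs_mul, abs_of_nonneg (phononSpectrum_nonneg y), ← div_eq_mul_inv, le_div_iff₀ h0]
  calc |η y| * phononSpectrum y * (1 + y ^ 2) ≤ (1 + y ^ 2) * phononSpectrum y * (1 + y ^ 2) := by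
        have := phononSpectrum_nonneg y
        gcongr
        exact hb y
    _ = phononSpectrum y * (1 + y ^ 2) ^ 2 := by ring
    _ ≤ C := hC y

theorem isProfile_phononSpectrum : IsProfile phononSpectrum := by
  have := isProfile_mul_phononSpectrum (η := fun _ => 1) measurable_const
    (fun y => by simpa using sq_nonneg y)
  simpa using this

theorem isProfile_id_mul_phononSpectrum : IsProfile fun y => y * phononSpectrum y :=
  isProfile_mul_phononSpectrum measurable_id fun y => by
    nlinarith [sq_nonneg (|y| - 1), sq_abs y, abs_nonneg y]

theorem isProfile_sq_mul_phononSpectrum : IsProfile fun y => y ^ 2 * phononSpectrum y :=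
  isProfile_mul_phononSpectrum (measurable_id.pow_const 2) fun y => by
    simp only [abs_pow, sq_abs]
    linarith

theorem measurable_kbar : Measurable fun p : ℝ × ℝ => kbar p.1 p.2 := by
  simp only [kbar_eq]
  refine Measurable.mul ?_ ((measurable_phononSpectrum.comp measurable_snd).div_const 2)
  exact (Real.measurable_cosh.comp (measurable_fst.div_const 2)).div
    (Real.measurable_cosh.comp ((measurable_fst.add measurable_snd).div_const 2))

theorem kbar_nonneg (x y : ℝ) : 0 ≤ kbar x y := by
  rw [kbar_eq]
  have := phononSpectrum_nonneg y
  have := Real.cosh_pos (x / 2)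
  have := Real.cosh_pos ((x + y) / 2)
  positivity

theorem kbar_le (x y : ℝ) : kbar x y ≤ Real.cosh (x / 2) * (phononSpectrum y / 2) := by
  rw [kbar_eq]
  have := phononSpectrum_nonneg y
  exact mul_le_mul_of_nonneg_right (div_le_self (Real.cosh_pos _).le (Real.one_le_cosh _))
    (by positivity)

theorem integrable_kbar (x : ℝ) : Integrable (kbar x) :=
  ((isProfile_phononSpectrum.integrable.div_const 2).const_mul (Real.cosh (x / 2))).mono'
    (measurable_kbar.comp measurable_prodMk_left).aestronglyMeasurable
    (Eventually.of_forall fun y => by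
      rw [Real.norm_of_nonneg (kbar_nonneg x y)]; exact kbar_le x y)

theorem measurable_rate : Measurable rate := by
  have : StronglyMeasurable fun x => ∫ y, kbar x y :=
    (measurable_kbar.stronglyMeasurable).integral_prod_right (ν := volume)
  exact this.measurable

theorem kbar_neg (x y : ℝ) : kbar (-x) (-y) = kbar x y := by
  rw [kbar_eq, kbar_eq, phononSpectrum_neg, neg_div, Real.cosh_neg, ← neg_add, neg_div, Real.cosh_neg]

theorem rate_neg (x : ℝ) : rate (-x) = rate x := by
  rw [rate, ← integral_neg_eq_self]
  simp only [kbar_neg, rate]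

theorem cosh_div_cosh_ge (x y : ℝ) :
    Real.exp (-(|y| / 2)) ≤ Real.cosh (x / 2) / Real.cosh ((x + y) / 2) := by
  rw [le_div_iff₀ (Real.cosh_pos _)]
  have h1 : Real.exp ((x + y) / 2) * Real.exp (-(|y| / 2)) ≤ Real.exp (x / 2) := by
    rw [← Real.exp_add, Real.exp_le_exp]; linarith [le_abs_self y]
  have h2 : Real.exp (-((x + y) / 2)) * Real.exp (-(|y| / 2)) ≤ Real.exp (-(x / 2)) := by
    rw [← Real.exp_add, Real.exp_le_exp]; linarith [neg_abs_le y]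
  rw [Real.cosh_eq, Real.cosh_eq]
  linarith

/-- Shifting the argument of cosh by y/2 costs at most e^{|y|/2} uniformly in x, so one integrand
independent of x lies below all the kernels. -/
theorem exists_rate_ge : ∃ c : ℝ, 0 < c ∧ ∀ x, c ≤ rate x := by
  have hm : Measurable fun y : ℝ => Real.exp (-(|y| / 2)) * (phononSpectrum y / 2) :=
    (Real.measurable_exp.comp ((measurable_id.abs.div_const 2).neg)).mul
      (measurable_phononSpectrum.div_const 2)
  have hi : Integrable fun y : ℝ => Real.exp (-(|y| / 2)) * (phononSpectrum y / 2) := by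
    refine (isProfile_phononSpectrum.integrable.div_const 2).mono' hm.aestronglyMeasurable
      (Eventually.of_forall fun y => ?_)
    have := phononSpectrum_nonneg y
    rw [Real.norm_of_nonneg (by positivity)]
    refine mul_le_of_le_one_left (by positivity) ?_
    rw [Real.exp_le_one_iff]
    have := abs_nonneg y
    linarith
  refine ⟨∫ y, Real.exp (-(|y| / 2)) * (phononSpectrum y / 2), ?_, fun x => ?_⟩
  · rw [integral_pos_iff_support_of_nonneg (fun y => by
      have := phononSpectrum_nonneg y
      positivity) hi]
    refine lt_of_lt_of_le (b := volume (Set.Ioo (0 : ℝ) 1)) (by simp) (measure_mono ?_)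
    intro y hy
    have := phononSpectrum_pos hy.1.ne'
    simp only [Function.mem_support]
    positivity
  · refine integral_mono hi (integrable_kbar x) fun y => ?_
    simp only [kbar_eq]
    exact mul_le_mul_of_nonneg_right (cosh_div_cosh_ge x y) (by linarith [phononSpectrum_nonneg y])

/-- In this range the exponential bounds on cosh((x+y)/2) and sinh(-y/2) multiply to e^{x/2}, which
cosh(x/2) compensates. It yields the cubic growth of the rate. -/
theorem sq_div_two_le_kbar {x y : ℝ} (hy : -x ≤ y) (hy0 : y ≤ 0) : y ^ 2 / 2 ≤ kbar x y := by
  rcases hy0.eq_or_lt with rfl | hy0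
  · simp [kbar]
  rw [kbar_eq, phononSpectrum]
  have hs : Real.sinh (y / 2) < 0 := Real.sinh_neg_iff.2 (by linarith)
  rw [abs_of_neg hs, ← Real.sinh_neg]
  have hs' : 0 < Real.sinh (-(y / 2)) := Real.sinh_pos_iff.2 (by linarith)
  have h1 : Real.sinh (-(y / 2)) * 2 ≤ Real.exp (-(y / 2)) := by
    rw [Real.sinh_eq]; linarith [Real.exp_pos (-(-(y / 2)))]
  have h2 : Real.cosh ((x + y) / 2) ≤ Real.exp ((x + y) / 2) := by
    rw [Real.cosh_eq]
    have : Real.exp (-((x + y) / 2)) ≤ Real.exp ((x + y) / 2) := Real.exp_le_exp.2 (by linarith)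
    linarith
  have h3 : Real.exp (x / 2) ≤ 2 * Real.cosh (x / 2) := by
    rw [Real.cosh_eq]; linarith [Real.exp_pos (-(x / 2))]
  have h4 : Real.cosh ((x + y) / 2) * (Real.sinh (-(y / 2)) * 2) ≤ 2 * Real.cosh (x / 2) := by
    calc _ ≤ Real.exp ((x + y) / 2) * Real.exp (-(y / 2)) :=
          mul_le_mul h2 h1 (by positivity) (by positivity)
      _ = Real.exp (x / 2) := by rw [← Real.exp_add]; congr 1; ring
      _ ≤ _ := h3
  have hc := Real.cosh_pos ((x + y) / 2)
  rw [div_div, div_mul_div_comm, div_le_div_iff₀ (by positivity) (by positivity)]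
  have := mul_le_mul_of_nonneg_left h4 (sq_nonneg y)
  linarith

theorem abs_cube_le_rate (x : ℝ) : |x| ^ 3 / 6 ≤ rate x := by
  wlog hx : 0 ≤ x generalizing x
  · have := this (-x) (by linarith)
    rwa [abs_neg, rate_neg] at this
  rw [abs_of_nonneg hx]
  have h1 : ∫ y in Set.Ioc (-x) 0, y ^ 2 / 2 = x ^ 3 / 6 := by
    rw [← intervalIntegral.integral_of_le (by linarith), intervalIntegral.integral_div,
      integral_pow]
    norm_num
    ring
  rw [← h1]
  calc ∫ y in Set.Ioc (-x) 0, y ^ 2 / 2 ≤ ∫ y in Set.Ioc (-x) 0, kbar x y := by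
        refine setIntegral_mono_on ?_ (integrable_kbar x).integrableOn measurableSet_Ioc
          fun y hy => sq_div_two_le_kbar hy.1.le hy.2
        exact (by fun_prop : Continuous fun y : ℝ => y ^ 2 / 2).integrableOn_Ioc
    _ ≤ ∫ y, kbar x y := setIntegral_le_integral (integrable_kbar x)
        (Eventually.of_forall (kbar_nonneg x))

theorem rate_pos (x : ℝ) : 0 < rate x := by
  obtain ⟨c, hc, h⟩ := exists_rate_ge
  exact hc.trans_le (h x)

theorem exists_inv_rate_le : ∃ C : ℝ, 0 < C ∧ ∀ x, (rate x)⁻¹ ≤ C * (1 + x ^ 2)⁻¹ := by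
  obtain ⟨c, hc, h⟩ := exists_rate_ge
  -- 2/c serves |x| ≤ 1, where 1 + x² ≤ 2. For |x| ≥ 1, 1 + x² ≤ 2|x|³ ≤ 12 g(x).
  refine ⟨2 / c + 12, by positivity, fun x => ?_⟩
  have hg := rate_pos x
  rw [← div_eq_mul_inv, inv_le_comm₀ hg (by positivity), inv_div, div_le_iff₀ (by positivity)]
  rcases le_total |x| 1 with h1 | h1
  · have h2 : x ^ 2 ≤ 1 := by rw [← sq_abs]; nlinarith [abs_nonneg x]
    have h3 : 2 ≤ rate x * (2 / c) := by
      calc 2 = c * (2 / c) := by field_simp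
        _ ≤ _ := mul_le_mul_of_nonneg_right (h x) (by positivity)
    linarith
  · have h2 := abs_cube_le_rate x
    have h3 : 0 ≤ rate x * (2 / c) := by positivity
    have h4 : 1 + x ^ 2 ≤ 2 * |x| ^ 3 := by
      rw [← sq_abs]; nlinarith [sq_nonneg (|x| - 1), sq_nonneg |x|]
    linarith

theorem one_add_sq_le_cosh (t : ℝ) : 1 + t ^ 2 ≤ 5 * Real.cosh t := by
  have h1 := pow_le_factorial_mul_exp (abs_nonneg t) 2
  rw [sq_abs] at h1
  norm_num [Nat.factorial] at h1
  have h2 : Real.exp |t| ≤ 2 * Real.cosh t := by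
    rw [← Real.cosh_abs, Real.cosh_eq]; linarith [Real.exp_pos (-|t|)]
  have h3 := Real.one_le_cosh t
  linarith

/-- The weight `ρ(x) = (w(x) g(x))^(1/2)`. -/
def amplitude (x : ℝ) : ℝ := √(rate x) / (2 * Real.cosh (x / 2))

theorem amplitude_pos (x : ℝ) : 0 < amplitude x := by
  have := rate_pos x
  have := Real.cosh_pos (x / 2)
  unfold amplitude; positivity

theorem amplitude_neg (x : ℝ) : amplitude (-x) = amplitude x := by
  rw [amplitude, amplitude, rate_neg, neg_div, Real.cosh_neg]

theorem amplitude_sq (x : ℝ) : amplitude x ^ 2 = rate x / (4 * Real.cosh (x / 2) ^ 2) := by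
  rw [amplitude, div_pow, Real.sq_sqrt (rate_pos x).le]; ring

theorem measurable_amplitude : Measurable amplitude :=
  measurable_rate.sqrt.div ((Real.measurable_cosh.comp (measurable_id.div_const 2)).const_mul 2)

/-- The rate grows at most like cosh(x/2), while the weight decays like its inverse square. Hence
constants belong to L²_σ. -/
theorem memLp_amplitude : MemLp amplitude 2 := by
  rw [memLp_two_iff_integrable_sq measurable_amplitude.aestronglyMeasurable]
  set I := ∫ y, phononSpectrum y / 2 with hI
  have hI0 : 0 ≤ I := integral_nonneg fun y => by have := phononSpectrum_nonneg y; positivity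
  have hr : ∀ x, rate x ≤ Real.cosh (x / 2) * I := fun x => by
    rw [hI, ← integral_const_mul]
    exact integral_mono (integrable_kbar x)
      ((isProfile_phononSpectrum.integrable.div_const 2).const_mul _) (kbar_le x)
  refine (integrable_inv_one_add_sq.const_mul (5 * I)).mono'
    (measurable_amplitude.pow_const 2).aestronglyMeasurable (Eventually.of_forall fun x => ?_)
  rw [Real.norm_of_nonneg (sq_nonneg _), amplitude_sq, ← div_eq_mul_inv]
  have hc := Real.cosh_pos (x / 2)
  have h1 := one_add_sq_le_cosh (x / 2)
  rw [div_le_div_iff₀ (by positivity) (by positivity)]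
  have h2 : 1 + x ^ 2 ≤ 4 * (5 * Real.cosh (x / 2)) := by nlinarith
  calc rate x * (1 + x ^ 2) ≤ (Real.cosh (x / 2) * I) * (4 * (5 * Real.cosh (x / 2))) :=
        mul_le_mul (hr x) h2 (by positivity) (by positivity)
    _ = 5 * I * (4 * Real.cosh (x / 2) ^ 2) := by ring

/-! ### Symmetrized integral operators and parity on L²(ℝ) -/

/-- The factor `g(x)^(-1/2)`. -/
def invSqrtRate (x : ℝ) : ℝ := (√(rate x))⁻¹

/-- The symmetrized kernel `j(z - x) / (2 (g(x) g(z))^(1/2))` with profile `j`. -/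
def symKernel (j : ℝ → ℝ) (x z : ℝ) : ℝ := invSqrtRate x * j (z - x) * invSqrtRate z / 2

/-- The integral operator with symmetrized kernel. -/
def symOp (j ψ : ℝ → ℝ) (x : ℝ) : ℝ := ∫ z, symKernel j x z * ψ z

theorem invSqrtRate_pos (x : ℝ) : 0 < invSqrtRate x := by
  have := rate_pos x
  unfold invSqrtRate; positivity

theorem invSqrtRate_neg (x : ℝ) : invSqrtRate (-x) = invSqrtRate x := by
  rw [invSqrtRate, invSqrtRate, rate_neg]

theorem invSqrtRate_sq (x : ℝ) : invSqrtRate x ^ 2 = (rate x)⁻¹ := by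
  rw [invSqrtRate, inv_pow, Real.sq_sqrt (rate_pos x).le]

theorem invSqrtRate_mul_amplitude (x : ℝ) :
    invSqrtRate x * amplitude x = 1 / (2 * Real.cosh (x / 2)) := by
  have := Real.sqrt_pos.2 (rate_pos x)
  rw [invSqrtRate, amplitude]
  field_simp

theorem measurable_invSqrtRate : Measurable invSqrtRate := measurable_rate.sqrt.inv

theorem measurable_symKernel {j : ℝ → ℝ} (hj : Measurable j) :
    Measurable fun p : ℝ × ℝ => symKernel j p.1 p.2 :=
  ((((measurable_invSqrtRate.comp measurable_fst).mul
    (hj.comp (measurable_snd.sub measurable_fst))).mul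
    (measurable_invSqrtRate.comp measurable_snd))).div_const 2

/-- The factor 1/g(z) is bounded, leaving j² to be integrated in z; 1/g(x) supplies the decay in x.
Together they make the kernel Hilbert–Schmidt. -/
theorem exists_symKernel_sq_bound {j : ℝ → ℝ} (hj : IsProfile j) :
    ∃ C : ℝ, ∀ x, Integrable (fun z => symKernel j x z ^ 2) ∧
      ∫ z, symKernel j x z ^ 2 ≤ C * (1 + x ^ 2)⁻¹ := by
  obtain ⟨C, hC0, hC⟩ := exists_inv_rate_le
  have hC1 : ∀ x, (rate x)⁻¹ ≤ C := fun x => (hC x).trans <|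
    mul_le_of_le_one_right hC0.le (inv_le_one_of_one_le₀ (by nlinarith))
  have hle : ∀ x z, symKernel j x z ^ 2 ≤ C * (C * (1 + x ^ 2)⁻¹) * j (z - x) ^ 2 := by
    intro x z
    have e : symKernel j x z ^ 2 = (rate z)⁻¹ * (rate x)⁻¹ * j (z - x) ^ 2 / 4 := by
      rw [← invSqrtRate_sq, ← invSqrtRate_sq, symKernel]; ring
    have hx := rate_pos x
    have hz := rate_pos z
    have h1 : (rate z)⁻¹ * (rate x)⁻¹ ≤ C * (C * (1 + x ^ 2)⁻¹) :=
      mul_le_mul (hC1 z) (hC x) (by positivity) hC0.le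
    have h2 := mul_le_mul_of_nonneg_right h1 (sq_nonneg (j (z - x)))
    have h3 : 0 ≤ (rate z)⁻¹ * (rate x)⁻¹ * j (z - x) ^ 2 := by positivity
    rw [e]; linarith
  have hkint : ∀ x, Integrable fun z => j (z - x) ^ 2 := fun x =>
    hj.integrable_sq.comp_sub_right x
  have hk : ∀ x, Integrable (fun z => symKernel j x z ^ 2) := fun x =>
    ((hkint x).const_mul _).mono'
      (((measurable_symKernel hj.measurable).comp
        measurable_prodMk_left).pow_const 2).aestronglyMeasurable
      (Eventually.of_forall fun z => by
        rw [Real.norm_of_nonneg (sq_nonneg _)]; exact hle x z)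
  refine ⟨C * C * ∫ y, j y ^ 2, fun x => ⟨hk x, ?_⟩⟩
  calc ∫ z, symKernel j x z ^ 2 ≤ ∫ z, C * (C * (1 + x ^ 2)⁻¹) * j (z - x) ^ 2 :=
        integral_mono (hk x) ((hkint x).const_mul _) (hle x)
    _ = C * (C * (1 + x ^ 2)⁻¹) * ∫ y, j y ^ 2 := by
        rw [integral_const_mul, integral_sub_right_eq_self (fun y => j y ^ 2) x]
    _ = _ := by ring

theorem memLp_symKernel {j : ℝ → ℝ} (hj : IsProfile j) (x : ℝ) : MemLp (symKernel j x) 2 := by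
  obtain ⟨C, hC⟩ := exists_symKernel_sq_bound hj
  exact (memLp_two_iff_integrable_sq ((measurable_symKernel hj.measurable).comp
    measurable_prodMk_left).aestronglyMeasurable).2 (hC x).1

theorem integrable_symKernel_mul {j ψ : ℝ → ℝ} (hj : IsProfile j) (hψ : MemLp ψ 2) (x : ℝ) :
    Integrable fun z => symKernel j x z * ψ z :=
  (memLp_symKernel hj x).integrable_mul hψ

theorem symOp_congr {j φ ψ : ℝ → ℝ} (h : φ =ᵐ[volume] ψ) : symOp j φ = symOp j ψ := by
  funext x
  exact integral_congr_ae (h.mono fun z hz => by simp only [hz])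

/-- The Hilbert space `L²(ℝ)`. -/
abbrev L2R : Type := Lp ℝ 2 (volume : Measure ℝ)

theorem exists_symCLM {j : ℝ → ℝ} (hj : IsProfile j) :
    ∃ Op : L2R →L[ℝ] L2R, IsCompactOperator Op ∧ ∀ φ : L2R, Op φ =ᵐ[volume] symOp j φ := by
  obtain ⟨C, hC⟩ := exists_symKernel_sq_bound hj
  have hin : ∀ (φ : L2R) (x : ℝ), ⟪(memLp_symKernel hj x).toLp _, φ⟫ = symOp j φ x := by
    intro φ x
    rw [L2.inner_def, symOp]
    refine integral_congr_ae ((memLp_symKernel hj x).coeFn_toLp.mono fun z hz => ?_)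
    simp only [hz, RCLike.inner_apply, conj_trivial, mul_comm]
  have hm : ∀ φ : L2R,
      AEStronglyMeasurable (fun x => ⟪(memLp_symKernel hj x).toLp _, φ⟫) volume := by
    intro φ
    simp only [hin]
    have : StronglyMeasurable fun p : ℝ × ℝ => symKernel j p.1 p.2 * φ p.2 :=
      (measurable_symKernel hj.measurable).stronglyMeasurable.mul
        ((Lp.stronglyMeasurable φ).comp_measurable measurable_snd)
    exact (this.integral_prod_right (ν := volume)).aestronglyMeasurable
  have hb : ∀ x, ‖(memLp_symKernel hj x).toLp _‖ ^ 2 ≤ C * (1 + x ^ 2)⁻¹ := by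
    intro x
    rw [norm_sq_Lp_eq_integral]
    refine le_trans (le_of_eq ?_) (hC x).2
    exact integral_congr_ae ((memLp_symKernel hj x).coeFn_toLp.mono fun z hz => by simp only [hz])
  obtain ⟨Op, h1, h2⟩ :=
    exists_compact_carleman _ _ (integrable_inv_one_add_sq.const_mul C) hm hb
  exact ⟨Op, h1, fun φ => (h2 φ).trans (Eventually.of_forall fun x => hin φ x)⟩

/-- The bounded operator on `L²(ℝ)` with kernel `symKernel j`. -/
def symCLM {j : ℝ → ℝ} (hj : IsProfile j) : L2R →L[ℝ] L2R := (exists_symCLM hj).choose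

theorem isCompactOperator_symCLM {j : ℝ → ℝ} (hj : IsProfile j) : IsCompactOperator (symCLM hj) :=
  (exists_symCLM hj).choose_spec.1

theorem symCLM_ae {j : ℝ → ℝ} (hj : IsProfile j) (φ : L2R) :
    symCLM hj φ =ᵐ[volume] symOp j φ := (exists_symCLM hj).choose_spec.2 φ

theorem memLp_symOp {j ψ : ℝ → ℝ} (hj : IsProfile j) (hψ : MemLp ψ 2) : MemLp (symOp j ψ) 2 := by
  rw [← symOp_congr hψ.coeFn_toLp]
  exact (memLp_congr_ae (symCLM_ae hj (hψ.toLp ψ))).1 (Lp.memLp _)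

theorem symCLM_toLp {j ψ : ℝ → ℝ} (hj : IsProfile j) (hψ : MemLp ψ 2) :
    symCLM hj (hψ.toLp ψ) = (memLp_symOp hj hψ).toLp _ := by
  refine Lp.ext ((symCLM_ae hj _).trans ?_)
  rw [symOp_congr hψ.coeFn_toLp]
  exact (memLp_symOp hj hψ).coeFn_toLp.symm

theorem IsProfile.abs {j : ℝ → ℝ} (hj : IsProfile j) : IsProfile fun y => |j y| :=
  ⟨hj.measurable.abs, by simpa using hj.bound⟩

/-- Taking absolute values leaves a kernel of the same type, with profile |j|, so boundedness of
that operator justifies Fubini. -/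
theorem integrable_prod_symKernel {j : ℝ → ℝ} (hj : IsProfile j) (φ ψ : L2R) :
    Integrable (fun p : ℝ × ℝ => φ p.1 * (symKernel j p.1 p.2 * ψ p.2))
      (volume.prod volume) := by
  have hm : StronglyMeasurable fun p : ℝ × ℝ => φ p.1 * (symKernel j p.1 p.2 * ψ p.2) :=
    ((Lp.stronglyMeasurable φ).comp_measurable measurable_fst).mul
      ((measurable_symKernel hj.measurable).stronglyMeasurable.mul
        ((Lp.stronglyMeasurable ψ).comp_measurable measurable_snd))
  rw [integrable_prod_iff hm.aestronglyMeasurable]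
  refine ⟨Eventually.of_forall fun x =>
    (integrable_symKernel_mul hj (Lp.memLp ψ) x).const_mul (φ x), ?_⟩
  have e : (fun x => ∫ z, ‖φ x * (symKernel j x z * ψ z)‖) =
      fun x => ‖φ x‖ * symOp (fun y => |j y|) (fun z => ‖ψ z‖) x := by
    funext x
    rw [symOp, ← integral_const_mul]
    refine integral_congr_ae (Eventually.of_forall fun z => ?_)
    simp only [norm_mul, symKernel, norm_div, Real.norm_eq_abs, abs_of_pos (invSqrtRate_pos _)]
    norm_num
  rw [e]
  exact (Lp.memLp φ).norm.integrable_mul (memLp_symOp hj.abs (Lp.memLp ψ).norm)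

theorem inner_symCLM {j : ℝ → ℝ} (hj : IsProfile j) (φ ψ : L2R) :
    ⟪φ, symCLM hj ψ⟫ =
      ∫ p : ℝ × ℝ, φ p.1 * (symKernel j p.1 p.2 * ψ p.2) ∂(volume.prod volume) := by
  rw [integral_prod _ (integrable_prod_symKernel hj φ ψ), L2.inner_def]
  refine integral_congr_ae ((symCLM_ae hj ψ).mono fun x hx => ?_)
  simp only [hx, RCLike.inner_apply, conj_trivial, symOp, integral_const_mul, mul_comm]

/-- The profile depends on z - x, so its parity s decides between symmetry and antisymmetry; since
the rate is even, the same sign governs reflection. -/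
theorem symKernel_swap {j : ℝ → ℝ} {s : ℝ} (hs : ∀ y, j (-y) = s * j y) (x z : ℝ) :
    symKernel j z x = s * symKernel j x z := by
  rw [symKernel, symKernel, ← neg_sub z x, hs]; ring

theorem inner_symCLM_left {j : ℝ → ℝ} (hj : IsProfile j) {s : ℝ} (hs : ∀ y, j (-y) = s * j y)
    (φ ψ : L2R) : ⟪symCLM hj φ, ψ⟫ = s * ⟪φ, symCLM hj ψ⟫ := by
  rw [real_inner_comm, inner_symCLM, inner_symCLM, ← integral_prod_swap, ← integral_const_mul]
  refine integral_congr_ae (Eventually.of_forall fun p => ?_)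
  simp only [Prod.fst_swap, Prod.snd_swap, symKernel_swap hs p.1 p.2]
  ring

theorem symKernel_neg_neg {j : ℝ → ℝ} {s : ℝ} (hs : ∀ y, j (-y) = s * j y) (x z : ℝ) :
    symKernel j (-x) (-z) = s * symKernel j x z := by
  rw [symKernel, symKernel, invSqrtRate_neg, invSqrtRate_neg, show -z - -x = -(z - x) by ring, hs]
  ring

theorem symOp_neg {j : ℝ → ℝ} {s : ℝ} (hs : ∀ y, j (-y) = s * j y) (ψ : ℝ → ℝ) (x : ℝ) :
    symOp j ψ (-x) = s * symOp j (fun z => ψ (-z)) x := by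
  rw [symOp, ← integral_neg_eq_self, symOp, ← integral_const_mul]
  simp only [symKernel_neg_neg hs, mul_assoc]

/-- The parity operator `φ(x) ↦ φ(-x)` on `L²(ℝ)`. -/
def parity : L2R →L[ℝ] L2R :=
  (Lp.compMeasurePreservingₗᵢ ℝ (fun x : ℝ => -x)
    (Measure.measurePreserving_neg volume)).toContinuousLinearMap

theorem parity_ae (φ : L2R) : parity φ =ᵐ[volume] fun x => φ (-x) :=
  Lp.coeFn_compMeasurePreserving φ (Measure.measurePreserving_neg (volume : Measure ℝ))

theorem ae_neg {p : ℝ → Prop} (h : ∀ᵐ x : ℝ, p x) : ∀ᵐ x : ℝ, p (-x) :=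
  (Measure.measurePreserving_neg (volume : Measure ℝ)).quasiMeasurePreserving.ae h

theorem parity_parity (φ : L2R) : parity (parity φ) = φ := by
  refine Lp.ext ?_
  filter_upwards [parity_ae (parity φ), ae_neg (parity_ae φ)] with x h1 h2
  rw [h1, h2, neg_neg]

theorem inner_parity (φ ψ : L2R) : ⟪parity φ, ψ⟫ = ⟪φ, parity ψ⟫ := by
  rw [L2.inner_def, L2.inner_def, ← integral_neg_eq_self]
  refine integral_congr_ae ?_
  filter_upwards [ae_neg (parity_ae φ), parity_ae ψ] with x h1 h2
  rw [h1, h2, neg_neg]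

theorem parity_symCLM {j : ℝ → ℝ} (hj : IsProfile j) {s : ℝ} (hs : ∀ y, j (-y) = s * j y)
    (φ : L2R) : parity (symCLM hj φ) = s • symCLM hj (parity φ) := by
  refine Lp.ext ?_
  filter_upwards [parity_ae (symCLM hj φ), ae_neg (symCLM_ae hj φ), symCLM_ae hj (parity φ),
    Lp.coeFn_smul s (symCLM hj (parity φ))] with x h1 h2 h3 h4
  rw [h1, h2, h4, Pi.smul_apply, h3, symOp_neg hs, symOp_congr (parity_ae φ), smul_eq_mul]

theorem parity_toLp_even {f : ℝ → ℝ} (hf : MemLp f 2) (h : ∀ᵐ x, f (-x) = f x) :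
    parity (hf.toLp f) = hf.toLp f := by
  refine Lp.ext ?_
  filter_upwards [parity_ae (hf.toLp f), ae_neg hf.coeFn_toLp, hf.coeFn_toLp, h] with x h1 h2 h3 h4
  rw [h1, h2, h3, h4]

theorem symOp_amplitude (j : ℝ → ℝ) (x : ℝ) :
    symOp j amplitude x = invSqrtRate x / 4 * ∫ y, j y / Real.cosh ((x + y) / 2) := by
  rw [symOp, ← integral_const_mul, ← integral_add_right_eq_self _ x]
  refine integral_congr_ae (Eventually.of_forall fun y => ?_)
  have h := invSqrtRate_mul_amplitude (y + x)
  simp only [symKernel]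
  rw [show invSqrtRate x * j (y + x - x) * invSqrtRate (y + x) / 2 * amplitude (y + x) =
    invSqrtRate x * j (y + x - x) / 2 * (invSqrtRate (y + x) * amplitude (y + x)) by ring, h,
    add_sub_cancel_right, add_comm y x]
  have := (Real.cosh_pos ((x + y) / 2)).ne'
  field_simp
  ring

theorem rate_eq (x : ℝ) :
    rate x = Real.cosh (x / 2) / 2 * ∫ y, phononSpectrum y / Real.cosh ((x + y) / 2) := by
  rw [rate, ← integral_const_mul]
  refine integral_congr_ae (Eventually.of_forall fun y => ?_)
  simp only [kbar_eq]
  ring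

/-- This is the normalization ∫K₀(ε,u)du = 1 after symmetrization: K₀ fixes constants. -/
theorem symOp_phononSpectrum_amplitude (x : ℝ) :
    symOp phononSpectrum amplitude x = amplitude x := by
  have hc := Real.cosh_pos (x / 2)
  have h := rate_eq x
  have h2 : ∫ y, phononSpectrum y / Real.cosh ((x + y) / 2) = 2 * rate x / Real.cosh (x / 2) := by
    rw [h]; field_simp
  have hs := Real.sqrt_pos.2 (rate_pos x)
  have hss := Real.sq_sqrt (rate_pos x).le
  rw [symOp_amplitude, h2, invSqrtRate, amplitude]
  field_simp
  rw [hss]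
  ring

theorem integral_pos_of_forall_pos {f : ℝ → ℝ} (hf : Integrable f) (h : ∀ x, 0 < f x) :
    0 < ∫ x, f x := by
  rw [integral_pos_iff_support_of_nonneg (fun x => (h x).le) hf]
  have : Function.support f = Set.univ := Set.eq_univ_of_forall fun x => (h x).ne'
  simp [this]

theorem integrable_div_cosh {j : ℝ → ℝ} (hj : IsProfile j) (x : ℝ) :
    Integrable fun y => j y / Real.cosh ((x + y) / 2) := by
  refine hj.integrable.norm.mono' (hj.measurable.div (Real.measurable_cosh.comp
    ((measurable_const.add measurable_id).div_const 2))).aestronglyMeasurable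
    (Eventually.of_forall fun y => ?_)
  rw [norm_div]
  refine div_le_self (norm_nonneg _) ?_
  rw [Real.norm_of_nonneg (Real.cosh_pos _).le]
  exact Real.one_le_cosh _

theorem integral_pos_of_forall_ne_zero {f : ℝ → ℝ} (hf : Integrable f) (h0 : 0 ≤ f)
    (h : ∀ x, x ≠ 0 → 0 < f x) : 0 < ∫ x, f x := by
  rw [integral_pos_iff_support_of_nonneg h0 hf]
  refine lt_of_lt_of_le (b := volume (Set.Ioo (0 : ℝ) 1)) (by simp) (measure_mono ?_)
  exact fun y hy => (h y hy.1.ne').ne'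

theorem symOp_sq_amplitude_pos (x : ℝ) :
    0 < symOp (fun y => y ^ 2 * phononSpectrum y) amplitude x := by
  rw [symOp_amplitude]
  have hr := invSqrtRate_pos x
  refine mul_pos (by positivity) (integral_pos_of_forall_ne_zero
    (integrable_div_cosh isProfile_sq_mul_phononSpectrum x) (fun y => ?_) fun y hy => ?_)
  · have := phononSpectrum_nonneg y
    have := Real.cosh_pos ((x + y) / 2)
    simp only [Pi.zero_apply]
    positivity
  · have := phononSpectrum_pos hy
    have := Real.cosh_pos ((x + y) / 2)
    positivity

/-- Pair y with -y: for x > 0 the weight 1/cosh((x+y)/2) is smaller at positive y, so the odd moment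
is negative. -/
theorem symOp_id_amplitude_neg {x : ℝ} (hx : 0 < x) :
    symOp (fun y => y * phononSpectrum y) amplitude x < 0 := by
  rw [symOp_amplitude]
  have hr := invSqrtRate_pos x
  refine mul_neg_of_pos_of_neg (by positivity) ?_
  set F : ℝ → ℝ := fun y => y * phononSpectrum y / Real.cosh ((x + y) / 2) with hF
  have hFi : Integrable F := integrable_div_cosh isProfile_id_mul_phononSpectrum x
  have e : ∫ y, -(F y + F (-y)) = -2 * ∫ y, F y := by
    rw [integral_neg, integral_add hFi hFi.comp_neg, integral_neg_eq_self]; ring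
  have hval : ∀ y, -(F y + F (-y)) = phononSpectrum y * (y * (Real.cosh ((x + y) / 2) -
      Real.cosh ((x - y) / 2))) / (Real.cosh ((x + y) / 2) * Real.cosh ((x - y) / 2)) := by
    intro y
    have h1 := (Real.cosh_pos ((x + y) / 2)).ne'
    have h2 := (Real.cosh_pos ((x - y) / 2)).ne'
    simp only [hF, phononSpectrum_neg, ← sub_eq_add_neg]
    field_simp
    ring
  have hsign : ∀ y, y ≠ 0 → 0 < y * (Real.cosh ((x + y) / 2) - Real.cosh ((x - y) / 2)) := by
    intro y hy
    rcases lt_or_gt_of_ne hy with h | h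
    · refine mul_pos_of_neg_of_neg h (sub_neg.2 (Real.cosh_lt_cosh.2 ?_))
      rw [← sq_lt_sq]; nlinarith
    · refine mul_pos h (sub_pos.2 (Real.cosh_lt_cosh.2 ?_))
      rw [← sq_lt_sq]; nlinarith
  have hpos : ∀ y, y ≠ 0 → 0 < -(F y + F (-y)) := by
    intro y hy
    rw [hval]
    have := Real.cosh_pos ((x + y) / 2)
    have := Real.cosh_pos ((x - y) / 2)
    exact div_pos (mul_pos (phononSpectrum_pos hy) (hsign y hy)) (by positivity)
  have := integral_pos_of_forall_ne_zero (hFi.add hFi.comp_neg).neg (fun y => ?_) hpos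
  · change 0 < ∫ y, -(F y + F (-y)) at this
    rw [e] at this
    linarith
  · rcases eq_or_ne y 0 with rfl | hy
    · simp [hF]
    · exact (hpos y hy).le

/-! ### Dirichlet form, spectral gap and the concrete model -/

/-- The rescaled scattering operator `K₀`. -/
def scattering : L2R →L[ℝ] L2R := symCLM isProfile_phononSpectrum

/-- The equilibrium state: the image of the constant function `1`. -/
def equilibrium : L2R := memLp_amplitude.toLp amplitude

theorem scattering_equilibrium : scattering equilibrium = equilibrium := by
  rw [scattering, equilibrium, symCLM_toLp]
  exact MemLp.toLp_congr _ _ (Eventually.of_forall symOp_phononSpectrum_amplitude)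

theorem symKernel_phononSpectrum_nonneg (x z : ℝ) : 0 ≤ symKernel phononSpectrum x z := by
  have := invSqrtRate_pos x
  have := invSqrtRate_pos z
  have := phononSpectrum_nonneg (z - x)
  unfold symKernel; positivity

theorem symKernel_phononSpectrum_pos {x z : ℝ} (h : z ≠ x) : 0 < symKernel phononSpectrum x z := by
  have := invSqrtRate_pos x
  have := invSqrtRate_pos z
  have := phononSpectrum_pos (sub_ne_zero.2 h)
  unfold symKernel; positivity

theorem symKernel_phononSpectrum_comm (x z : ℝ) :
    symKernel phononSpectrum z x = symKernel phononSpectrum x z := by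
  rw [symKernel_swap (s := 1) (fun y => by rw [phononSpectrum_neg, one_mul]), one_mul]

theorem integral_symKernel_amplitude (x : ℝ) (c : ℝ) :
    ∫ z, symKernel phononSpectrum x z * amplitude z / amplitude x * c = c := by
  have h := symOp_phononSpectrum_amplitude x
  rw [integral_mul_const, integral_div, ← symOp, h, div_self (amplitude_pos x).ne', one_mul]

theorem integrable_prod_diagonal (φ : L2R) :
    Integrable (fun p : ℝ × ℝ => symKernel phononSpectrum p.1 p.2 * amplitude p.2 /
      amplitude p.1 * φ p.1 ^ 2) (volume.prod volume) := by
  have hm : StronglyMeasurable fun p : ℝ × ℝ => symKernel phononSpectrum p.1 p.2 *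
      amplitude p.2 / amplitude p.1 * φ p.1 ^ 2 :=
    (((measurable_symKernel measurable_phononSpectrum).mul
      (measurable_amplitude.comp measurable_snd)).div
      (measurable_amplitude.comp measurable_fst)).stronglyMeasurable.mul
      (((Lp.stronglyMeasurable φ).comp_measurable measurable_fst).pow 2)
  rw [integrable_prod_iff hm.aestronglyMeasurable]
  refine ⟨Eventually.of_forall fun x =>
    ((integrable_symKernel_mul isProfile_phononSpectrum memLp_amplitude x).div_const
      (amplitude x)).mul_const (φ x ^ 2), ?_⟩
  have e : (fun x => ∫ z, ‖symKernel phononSpectrum x z * amplitude z / amplitude x * φ x ^ 2‖) =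
      fun x => φ x ^ 2 := by
    funext x
    refine Eq.trans ?_ (integral_symKernel_amplitude x (φ x ^ 2))
    refine integral_congr_ae (Eventually.of_forall fun z => Real.norm_of_nonneg ?_)
    have := symKernel_phononSpectrum_nonneg x z
    have := amplitude_pos x
    have := amplitude_pos z
    positivity
  rw [e]
  exact (Lp.memLp φ).integrable_sq

theorem integral_prod_diagonal (φ : L2R) :
    ∫ p : ℝ × ℝ, symKernel phononSpectrum p.1 p.2 * amplitude p.2 / amplitude p.1 * φ p.1 ^ 2
      ∂(volume.prod volume) = ‖φ‖ ^ 2 := by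
  rw [integral_prod _ (integrable_prod_diagonal φ), norm_sq_Lp_eq_integral]
  simp only [integral_symKernel_amplitude]

/-- The density of the Dirichlet form of `scattering`. -/
def dirichletDensity (φ ψ : ℝ → ℝ) (p : ℝ × ℝ) : ℝ :=
  symKernel phononSpectrum p.1 p.2 * amplitude p.1 * amplitude p.2 *
    (φ p.1 / amplitude p.1 - ψ p.2 / amplitude p.2) ^ 2

theorem dirichletDensity_nonneg (φ ψ : ℝ → ℝ) (p : ℝ × ℝ) : 0 ≤ dirichletDensity φ ψ p := by
  have := symKernel_phononSpectrum_nonneg p.1 p.2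
  have := amplitude_pos p.1
  have := amplitude_pos p.2
  unfold dirichletDensity; positivity

theorem dirichletDensity_eq (φ ψ : ℝ → ℝ) : dirichletDensity φ ψ = fun p : ℝ × ℝ =>
    symKernel phononSpectrum p.1 p.2 * amplitude p.2 / amplitude p.1 * φ p.1 ^ 2 +
    symKernel phononSpectrum p.swap.1 p.swap.2 * amplitude p.swap.2 / amplitude p.swap.1 *
      ψ p.swap.1 ^ 2 -
    2 * (φ p.1 * (symKernel phononSpectrum p.1 p.2 * ψ p.2)) := by
  funext p
  have h1 := (amplitude_pos p.1).ne'
  have h2 := (amplitude_pos p.2).ne'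
  simp only [dirichletDensity, Prod.fst_swap, Prod.snd_swap,
    symKernel_phononSpectrum_comm p.1 p.2]
  field_simp
  ring

theorem integrable_dirichletDensity (φ ψ : L2R) :
    Integrable (dirichletDensity φ ψ) (volume.prod volume) := by
  rw [dirichletDensity_eq]
  exact ((integrable_prod_diagonal φ).add (integrable_prod_diagonal ψ).swap).sub
    ((integrable_prod_symKernel isProfile_phononSpectrum φ ψ).const_mul 2)

/-- Expand the square: since K fixes the amplitude, the diagonal terms integrate to the norms. Two
independent arguments allow φ = Kψ for the norm bound and φ = ±ψ for the eigenvalues ±1. -/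
theorem integral_dirichletDensity (φ ψ : L2R) :
    ∫ p, dirichletDensity φ ψ p ∂(volume.prod volume) =
      ‖φ‖ ^ 2 + ‖ψ‖ ^ 2 - 2 * ⟪φ, scattering ψ⟫ := by
  rw [dirichletDensity_eq, integral_sub, integral_add, integral_const_mul, integral_prod_diagonal,
    scattering, inner_symCLM]
  · congr 2
    rw [← integral_prod_diagonal ψ]
    exact integral_prod_swap (μ := (volume : Measure ℝ)) (ν := (volume : Measure ℝ))
      fun p : ℝ × ℝ => symKernel phononSpectrum p.1 p.2 * amplitude p.2 / amplitude p.1 * ψ p.1 ^ 2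
  · exact integrable_prod_diagonal φ
  · exact (integrable_prod_diagonal ψ).swap
  · exact (integrable_prod_diagonal φ).add (integrable_prod_diagonal ψ).swap
  · exact (integrable_prod_symKernel isProfile_phononSpectrum φ ψ).const_mul 2

theorem norm_scattering_le (ψ : L2R) : ‖scattering ψ‖ ≤ ‖ψ‖ := by
  have h := integral_dirichletDensity (scattering ψ) ψ
  have h0 : 0 ≤ ∫ p, dirichletDensity (scattering ψ) ψ p ∂(volume.prod volume) :=
    integral_nonneg (dirichletDensity_nonneg _ _)
  rw [h, real_inner_self_eq_norm_sq] at h0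
  exact (abs_le_of_sq_le_sq' (by linarith) (norm_nonneg _)).2

/-- The Dirichlet density vanishes almost everywhere and the kernel is positive off the diagonal.
Fixing one good x forces ψ/`amplitude` to be constant. -/
theorem eq_smul_equilibrium_of_inner_eq (φ ψ : L2R)
    (h : ‖φ‖ ^ 2 + ‖ψ‖ ^ 2 - 2 * ⟪φ, scattering ψ⟫ = 0) : ∃ c : ℝ, ψ = c • equilibrium := by
  rw [← integral_dirichletDensity, integral_eq_zero_iff_of_nonneg (dirichletDensity_nonneg _ _)
    (integrable_dirichletDensity φ ψ)] at h
  have h2 := Measure.ae_ae_of_ae_prod h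
  obtain ⟨x, hx⟩ := h2.exists
  refine ⟨φ x / amplitude x, Lp.ext ?_⟩
  have hne : ∀ᵐ z : ℝ, z ≠ x := by simp [ae_iff, measure_singleton]
  filter_upwards [hx, hne, Lp.coeFn_smul (φ x / amplitude x) equilibrium,
    memLp_amplitude.coeFn_toLp] with z h1 h2 h3 h4
  rw [h3, Pi.smul_apply, equilibrium, h4, smul_eq_mul]
  simp only [dirichletDensity, Pi.zero_apply] at h1
  have e1 := symKernel_phononSpectrum_pos h2
  have e2 := amplitude_pos x
  have e3 := amplitude_pos z
  have h5 := (mul_eq_zero.1 h1).resolve_left (by positivity)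
  have h6 : φ x / amplitude x = ψ z / amplitude z := sub_eq_zero.1 (pow_eq_zero_iff two_ne_zero |>.1 h5)
  rw [h6, div_mul_cancel₀ _ e3.ne']

theorem scattering_fixed (x : L2R) (h : scattering x = x) : ∃ c : ℝ, x = c • equilibrium :=
  eq_smul_equilibrium_of_inner_eq x x (by rw [h, real_inner_self_eq_norm_sq]; ring)

theorem scattering_neg_fixed (x : L2R) (h : scattering x = -x) : x = 0 := by
  obtain ⟨c, hc⟩ := eq_smul_equilibrium_of_inner_eq (-x) x (by
    rw [h, inner_neg_neg, real_inner_self_eq_norm_sq, norm_neg]; ring)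
  have h1 : scattering x = x := by rw [hc, map_smul, scattering_equilibrium]
  rw [h1] at h
  rw [eq_neg_iff_add_eq_zero, ← two_smul ℝ] at h
  simpa using h

theorem memLp_amplitude_div_rate : MemLp (fun x => amplitude x / rate x) 2 := by
  obtain ⟨c, hc, h⟩ := exists_rate_ge
  refine (memLp_amplitude.const_mul c⁻¹).mono
    (measurable_amplitude.div measurable_rate).aestronglyMeasurable
    (Eventually.of_forall fun x => ?_)
  have h1 := amplitude_pos x
  have h2 := rate_pos x
  rw [Real.norm_of_nonneg (by positivity), Real.norm_of_nonneg (by positivity), inv_mul_eq_div]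
  exact div_le_div_of_nonneg_left h1.le hc (h x)

theorem inner_toLp {f g : ℝ → ℝ} (hf : MemLp f 2) (hg : MemLp g 2) :
    ⟪hf.toLp f, hg.toLp g⟫ = ∫ x, f x * g x := by
  rw [L2.inner_def]
  refine integral_congr_ae ?_
  filter_upwards [hf.coeFn_toLp, hg.coeFn_toLp] with x h1 h2
  simp only [h1, h2, RCLike.inner_apply, conj_trivial, mul_comm]

theorem exists_scattering_gap : ∃ ρ : ℝ, 0 ≤ ρ ∧ ρ < 1 ∧
    ∀ x, ⟪equilibrium, x⟫ = 0 → ‖scattering x‖ ≤ ρ * ‖x‖ :=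
  exists_strict_contraction_of_compact scattering equilibrium (isCompactOperator_symCLM _)
    (fun x y => by
      rw [scattering, inner_symCLM_left _ (s := 1)
        (fun y => by rw [phononSpectrum_neg, one_mul]), one_mul])
    norm_scattering_le scattering_equilibrium scattering_fixed scattering_neg_fixed

/-- The electron-phonon problem as a `LowTemperatureModel`. -/
def model : LowTemperatureModel L2R where
  K := scattering
  A := symCLM isProfile_id_mul_phononSpectrum
  B := symCLM isProfile_sq_mul_phononSpectrum
  N := parity
  v := equilibrium
  q := memLp_amplitude_div_rate.toLp _
  K_symm x y := by
    rw [scattering, inner_symCLM_left _ (s := 1) (fun y => by rw [phononSpectrum_neg, one_mul]),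
      one_mul]
  A_antisymm x y := by
    rw [inner_symCLM_left _ (s := -1) (fun y => by rw [phononSpectrum_neg]; ring), neg_one_mul]
  B_symm x y := by
    rw [inner_symCLM_left _ (s := 1) (fun y => by rw [phononSpectrum_neg]; ring), one_mul]
  N_symm := inner_parity
  N_N := parity_parity
  N_K x := by
    rw [scattering, parity_symCLM _ (s := 1) (fun y => by rw [phononSpectrum_neg, one_mul]),
      one_smul]
  N_A x := by
    rw [parity_symCLM _ (s := -1) (fun y => by rw [phononSpectrum_neg]; ring), neg_one_smul]
  N_B x := by
    rw [parity_symCLM _ (s := 1) (fun y => by rw [phononSpectrum_neg]; ring), one_smul]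
  K_v := scattering_equilibrium
  N_v := parity_toLp_even _ (Eventually.of_forall amplitude_neg)
  N_q := parity_toLp_even _ (Eventually.of_forall fun x => by rw [amplitude_neg, rate_neg])
  ρ := exists_scattering_gap.choose
  ρ_nonneg := exists_scattering_gap.choose_spec.1
  ρ_lt_one := exists_scattering_gap.choose_spec.2.1
  gap := exists_scattering_gap.choose_spec.2.2
  B_pos := by
    rw [equilibrium, symCLM_toLp, inner_toLp]
    exact integral_pos_of_forall_pos (memLp_amplitude.integrable_mul
      (memLp_symOp isProfile_sq_mul_phononSpectrum memLp_amplitude))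
      fun x => mul_pos (amplitude_pos x) (symOp_sq_amplitude_pos x)
  q_pos := by
    rw [equilibrium, inner_toLp]
    exact integral_pos_of_forall_pos (memLp_amplitude.integrable_mul memLp_amplitude_div_rate)
      fun x => mul_pos (amplitude_pos x) (div_pos (amplitude_pos x) (rate_pos x))

/-- Keeps the odd leading term nonzero, without which an error small relative to it could not be
claimed. -/
theorem model_A_v_ne_zero : model.A model.v ≠ 0 := by
  intro h
  have h1 : symCLM isProfile_id_mul_phononSpectrum (memLp_amplitude.toLp amplitude) = 0 := h
  rw [symCLM_toLp, Lp.eq_zero_iff_ae_eq_zero] at h1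
  replace h1 := (MemLp.coeFn_toLp _).symm.trans h1
  have h2 : volume (Set.Ioi (0 : ℝ)) = 0 :=
    measure_mono_null (fun x hx => (symOp_id_amplitude_neg hx).ne) h1
  simp at h2

theorem model_neumann_ne_zero : model.neumann (model.A model.v) ≠ 0 := by
  intro h
  have := model.neumann_sub _ (model.inner_v_of_odd model.N_A_v)
  rw [h, map_zero, sub_zero] at this
  exact model_A_v_ne_zero this.symm

/-! ### Rescaling between L²_σ and L²(ℝ) -/

/-- The rescaling `φ ↦ ρ(x) φ(T x)`, which maps `L²_σ` onto `L²(ℝ)`. -/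
def pull (T : ℝ) (φ : ℝ → ℝ) (x : ℝ) : ℝ := amplitude x * φ (T * x)

/-- The inverse of `pull T`. -/
def push (T : ℝ) (ψ : ℝ → ℝ) (ε : ℝ) : ℝ := ψ (ε / T) / amplitude (ε / T)

theorem pull_push {T : ℝ} (hT : 0 < T) (ψ : ℝ → ℝ) : pull T (push T ψ) = ψ := by
  funext x
  have := (amplitude_pos x).ne'
  rw [pull, push, mul_div_cancel_left₀ x hT.ne']
  field_simp

theorem push_pull {T : ℝ} (hT : 0 < T) (φ : ℝ → ℝ) : push T (pull T φ) = φ := by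
  funext ε
  have := (amplitude_pos (ε / T)).ne'
  rw [push, pull, mul_div_cancel₀ ε hT.ne']
  field_simp

theorem ae_mul_iff {T : ℝ} (hT : 0 < T) {p : ℝ → Prop} : (∀ᵐ x : ℝ, p (T * x)) ↔ ∀ᵐ ε, p ε := by
  have h := (measurableEmbedding_mulLeft₀ hT.ne').ae_map_iff (p := p) (μ := (volume : Measure ℝ))
  rw [← h]
  have h2 := Real.map_volume_mul_left hT.ne'
  rw [h2]
  rw [Measure.ae_ennreal_smul_measure_iff]
  simpa using hT.ne'

theorem pull_ae_eq_iff {T : ℝ} (hT : 0 < T) {φ ψ : ℝ → ℝ} :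
    pull T φ =ᵐ[volume] pull T ψ ↔ ∀ᵐ ε, φ ε = ψ ε := by
  rw [← ae_mul_iff hT]
  refine eventually_congr (Eventually.of_forall fun x => ?_)
  simp only [pull, mul_right_inj' (amplitude_pos x).ne']

theorem Γ₀_eq {T : ℝ} (hT : 0 < T) (ω₀ ε : ℝ) :
    Γ₀ ω₀ T ε = (T / ω₀) ^ 2 * (T * rate (ε / T)) := by
  simp only [Γ₀, Kbar₀]
  rw [integral_const_mul, integral_sub_right_eq_self (fun u => kbar (ε / T) (u / T)) ε,
    Measure.integral_comp_div, abs_of_pos hT, smul_eq_mul, rate]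

theorem Γ₀_pos {ω₀ T : ℝ} (hω₀ : 0 < ω₀) (hT : 0 < T) (ε : ℝ) : 0 < Γ₀ ω₀ T ε := by
  have := rate_pos (ε / T)
  rw [Γ₀_eq hT]; positivity

theorem weight_mul_Γ₀ {T : ℝ} (hT : 0 < T) (ω₀ ε : ℝ) :
    weight T ε * Γ₀ ω₀ T ε = T ^ 3 / ω₀ ^ 2 * amplitude (ε / T) ^ 2 := by
  rw [weight_eq, Γ₀_eq hT, amplitude_sq]
  ring

theorem measurable_density {T : ℝ} (hT : 0 < T) (ω₀ : ℝ) :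
    Measurable fun ε => ENNReal.ofReal (weight T ε * Γ₀ ω₀ T ε) := by
  simp only [weight_mul_Γ₀ hT]
  exact (((measurable_amplitude.comp (measurable_id.div_const T)).pow_const 2).const_mul
    _).ennreal_ofReal

/-- The density is T³/ω₀² times the squared amplitude and dε = T dx. The resulting factor is the
same for all φ, so it cancels in every leading-order comparison. -/
theorem eLpNorm_σ {ω₀ T : ℝ} (hω₀ : 0 < ω₀) (hT : 0 < T) (φ : ℝ → ℝ) :
    eLpNorm φ 2 (σ ω₀ T) = ENNReal.ofReal (T ^ 2 / ω₀) * eLpNorm (pull T φ) 2 volume := by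
  have hscale : ∀ f : ℝ → ENNReal, ∫⁻ ε, f ε = ENNReal.ofReal T * ∫⁻ x, f (T * x) := by
    intro f
    conv_lhs => rw [← Real.smul_map_volume_mul_left hT.ne', lintegral_smul_measure,
      (measurableEmbedding_mulLeft₀ hT.ne').lintegral_map, abs_of_pos hT]
    rfl
  have key : ∫⁻ ε, ‖φ ε‖ₑ ^ (2 : ℝ) ∂(σ ω₀ T) =
      ENNReal.ofReal (T ^ 2 / ω₀) ^ (2 : ℝ) * ∫⁻ x, ‖pull T φ x‖ₑ ^ (2 : ℝ) := by
    -- φ is arbitrary here, so only integral identities free of measurability of the integrand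
    -- apply.
    rw [σ, lintegral_withDensity_eq_lintegral_mul_non_measurable _ (measurable_density hT ω₀)
      (Eventually.of_forall fun _ => ENNReal.ofReal_lt_top), hscale,
      ← lintegral_const_mul' _ _ ENNReal.ofReal_ne_top, ← lintegral_const_mul' _ _ (by simp)]
    refine lintegral_congr fun x => ?_
    have ha := amplitude_pos x
    rw [Pi.mul_apply, weight_mul_Γ₀ hT, mul_div_cancel_left₀ x hT.ne', pull, enorm_mul,
      ENNReal.mul_rpow_of_nonneg _ _ (by norm_num), ← mul_assoc, ← mul_assoc,
      Real.enorm_of_nonneg ha.le, ENNReal.ofReal_rpow_of_nonneg (by positivity) (by norm_num),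
      ENNReal.ofReal_rpow_of_nonneg ha.le (by norm_num), ← ENNReal.ofReal_mul hT.le,
      ← ENNReal.ofReal_mul (by positivity)]
    congr 2
    norm_num
    field_simp
  rw [eLpNorm_eq_lintegral_rpow_enorm_toReal (by norm_num) (by norm_num),
    eLpNorm_eq_lintegral_rpow_enorm_toReal (by norm_num) (by norm_num)]
  simp only [ENNReal.toReal_ofNat]
  rw [key, ENNReal.mul_rpow_of_nonneg _ _ (by norm_num), ← ENNReal.rpow_mul]
  norm_num

theorem aestronglyMeasurable_σ_iff {ω₀ T : ℝ} (hω₀ : 0 < ω₀) (hT : 0 < T) (φ : ℝ → ℝ) :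
    AEStronglyMeasurable φ (σ ω₀ T) ↔ AEStronglyMeasurable (pull T φ) volume := by
  have h1 : σ ω₀ T ≪ volume := withDensity_absolutelyContinuous _ _
  have h2 : volume ≪ σ ω₀ T := by
    refine withDensity_absolutelyContinuous' (measurable_density hT ω₀).aemeasurable
      (Eventually.of_forall fun ε => ?_)
    have := amplitude_pos (ε / T)
    rw [weight_mul_Γ₀ hT, ← pos_iff_ne_zero, ENNReal.ofReal_pos]
    positivity
  constructor
  · intro h
    refine measurable_amplitude.aestronglyMeasurable.mul
      ((h.mono_ac h2).comp_quasiMeasurePreserving ⟨measurable_const_mul T, ?_⟩)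
    rw [Real.map_volume_mul_left hT.ne']
    exact Measure.smul_absolutelyContinuous
  · intro h
    rw [← push_pull hT φ]
    refine AEStronglyMeasurable.mono_ac h1 ?_
    have hq : Measure.QuasiMeasurePreserving (fun ε : ℝ => ε / T) volume volume := by
      refine ⟨measurable_id.div_const T, ?_⟩
      have : (fun ε : ℝ => ε / T) = (T⁻¹ * ·) := by funext ε; ring
      rw [this, Real.map_volume_mul_left (inv_ne_zero hT.ne')]
      exact Measure.smul_absolutelyContinuous
    exact (h.div₀ measurable_amplitude.aestronglyMeasurable).comp_quasiMeasurePreserving hq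

theorem memLp_σ_iff {ω₀ T : ℝ} (hω₀ : 0 < ω₀) (hT : 0 < T) {φ : ℝ → ℝ} :
    MemLp φ 2 (σ ω₀ T) ↔ MemLp (pull T φ) 2 := by
  rw [MemLp, MemLp, aestronglyMeasurable_σ_iff hω₀ hT, eLpNorm_σ hω₀ hT]
  refine and_congr_right fun _ => ?_
  have h0 : ENNReal.ofReal (T ^ 2 / ω₀) ≠ 0 := by
    rw [← pos_iff_ne_zero, ENNReal.ofReal_pos]; positivity
  constructor
  · intro h
    exact ENNReal.lt_top_of_mul_ne_top_right h.ne h0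
  · exact fun h => ENNReal.mul_lt_top ENNReal.ofReal_lt_top h

theorem eLpNorm_σ_of_ae {ω₀ T : ℝ} (hω₀ : 0 < ω₀) (hT : 0 < T) {φ : ℝ → ℝ} {X : L2R}
    (h : pull T φ =ᵐ[volume] X) :
    eLpNorm φ 2 (σ ω₀ T) = ENNReal.ofReal (T ^ 2 / ω₀ * ‖X‖) := by
  rw [eLpNorm_σ hω₀ hT, eLpNorm_congr_ae h, ENNReal.ofReal_mul (by positivity), Lp.norm_def,
    ENNReal.ofReal_toReal (Lp.eLpNorm_ne_top X)]

/-- The kernel `η((u - ε)/T) K₀(ε, u)`. -/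
def momentKernel (η : ℝ → ℝ) (ω₀ T ε u : ℝ) : ℝ := η ((u - ε) / T) * K₀ ω₀ T ε u

/-- Conjugation by the amplitude symmetrizes every moment kernel at once; the extra T is the
Jacobian of u = Tz. -/
theorem amplitude_mul_momentKernel {ω₀ T : ℝ} (hω₀ : 0 < ω₀) (hT : 0 < T) (η : ℝ → ℝ) (x z : ℝ) :
    amplitude x * (T * momentKernel η ω₀ T (T * x) (T * z)) =
      symKernel (fun y => η y * phononSpectrum y) x z * amplitude z := by
  have h := invSqrtRate_mul_amplitude z
  have hz := Real.cosh_pos (z / 2)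
  have hx := Real.cosh_pos (x / 2)
  have hr := rate_pos x
  have hs := Real.sqrt_pos.2 hr
  have hss := Real.sq_sqrt hr.le
  rw [symKernel, show invSqrtRate x * (η (z - x) * phononSpectrum (z - x)) * invSqrtRate z / 2 *
    amplitude z = invSqrtRate x * (η (z - x) * phononSpectrum (z - x)) / 2 *
    (invSqrtRate z * amplitude z) by ring, h, momentKernel, K₀, Γ₀_eq hT, Kbar₀,
    ← mul_sub, mul_div_cancel_left₀ x hT.ne', mul_div_cancel_left₀ _ hT.ne', kbar_eq,
    show x + (z - x) = z by ring, amplitude, invSqrtRate]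
  field_simp
  rw [hss]
  ring

theorem integrable_momentKernel_mul {ω₀ T : ℝ} (hω₀ : 0 < ω₀) (hT : 0 < T) {η φ : ℝ → ℝ}
    (hη : IsProfile fun y => η y * phononSpectrum y) (hφ : MemLp φ 2 (σ ω₀ T)) (ε : ℝ) :
    Integrable fun u => momentKernel η ω₀ T ε u * φ u := by
  rw [← integrable_comp_mul_left_iff _ hT.ne']
  have h := integrable_symKernel_mul hη ((memLp_σ_iff hω₀ hT).1 hφ) (ε / T)
  refine (h.const_mul (amplitude (ε / T) * T)⁻¹).congr (Eventually.of_forall fun z => ?_)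
  have e := amplitude_mul_momentKernel hω₀ hT η (ε / T) z
  rw [mul_div_cancel₀ ε hT.ne'] at e
  have ha := (amplitude_pos (ε / T)).ne'
  simp only [pull]
  rw [← mul_assoc (symKernel _ _ _), ← e]
  field_simp

theorem pull_momentKernel {ω₀ T : ℝ} (hω₀ : 0 < ω₀) (hT : 0 < T) (η φ : ℝ → ℝ) :
    pull T (intOp (momentKernel η ω₀ T) φ) =
      symOp (fun y => η y * phononSpectrum y) (pull T φ) := by
  funext x
  have h := Measure.integral_comp_mul_left (fun u => momentKernel η ω₀ T (T * x) u * φ u) T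
  rw [abs_of_pos (inv_pos.2 hT), smul_eq_mul] at h
  rw [pull, intOp, symOp, show ∫ u, momentKernel η ω₀ T (T * x) u * φ u =
    T * (T⁻¹ * ∫ u, momentKernel η ω₀ T (T * x) u * φ u) by field_simp, ← h,
    ← integral_const_mul, ← integral_const_mul]
  refine integral_congr_ae (Eventually.of_forall fun z => ?_)
  have e := amplitude_mul_momentKernel hω₀ hT η x z
  simp only [pull]
  rw [← mul_assoc (symKernel _ _ _), ← e]
  ring

theorem K₀_eq_momentKernel (ω₀ T : ℝ) : K₀ ω₀ T = momentKernel (fun _ => 1) ω₀ T := by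
  funext ε u
  rw [momentKernel, one_mul]

theorem K₁_eq_momentKernel {ω₀ : ℝ} (hω₀ : 0 < ω₀) (εF T ε u : ℝ) :
    K₁ ω₀ εF T ε u = 1 / (2 * εF) * T * momentKernel (fun y => y) ω₀ T ε u := by
  rw [K₁, Kbar₁, momentKernel, K₀]
  have : ω₀ / (2 * εF) * (T / ω₀) = 1 / (2 * εF) * T := by
    rw [div_mul_div_comm, mul_comm ω₀ T, mul_div_mul_right _ _ hω₀.ne']; ring
  rw [this]
  ring

theorem K₂_eq_momentKernel (ω₀ T ε u : ℝ) :
    K₂ ω₀ T ε u = 1 / (2 * ω₀ ^ 2) * T ^ 2 * momentKernel (fun y => y ^ 2) ω₀ T ε u := by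
  rw [K₂, Kbar₂, momentKernel, K₀]
  ring

theorem isProfile_one_mul : IsProfile fun y => (1 : ℝ) * phononSpectrum y := by
  simpa using isProfile_phononSpectrum

theorem pull_K₀ {ω₀ T : ℝ} (hω₀ : 0 < ω₀) (hT : 0 < T) (φ : ℝ → ℝ) :
    pull T (intOp (K₀ ω₀ T) φ) = symOp phononSpectrum (pull T φ) := by
  rw [K₀_eq_momentKernel, pull_momentKernel hω₀ hT]
  simp only [one_mul]

theorem pull_K₁ {ω₀ T : ℝ} (hω₀ : 0 < ω₀) (hT : 0 < T) (εF : ℝ) (φ : ℝ → ℝ) (x : ℝ) :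
    pull T (intOp (K₁ ω₀ εF T) φ) x =
      1 / (2 * εF) * T * symOp (fun y => y * phononSpectrum y) (pull T φ) x := by
  rw [← pull_momentKernel hω₀ hT (fun y => y) φ, pull, pull, intOp, intOp]
  simp only [K₁_eq_momentKernel hω₀]
  simp only [mul_assoc, integral_const_mul]
  ring

theorem pull_Kfull {ω₀ T : ℝ} (hω₀ : 0 < ω₀) (hT : 0 < T) (εF : ℝ) {φ : ℝ → ℝ}
    (hφ : MemLp φ 2 (σ ω₀ T)) (x : ℝ) :
    pull T (intOp (Kfull ω₀ εF T) φ) x = symOp phononSpectrum (pull T φ) x +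
      1 / (2 * εF) * T * symOp (fun y => y * phononSpectrum y) (pull T φ) x -
      1 / (2 * ω₀ ^ 2) * T ^ 2 * symOp (fun y => y ^ 2 * phononSpectrum y) (pull T φ) x := by
  have h0 := integrable_momentKernel_mul hω₀ hT (η := fun _ => 1) isProfile_one_mul hφ (T * x)
  have h1 := integrable_momentKernel_mul hω₀ hT isProfile_id_mul_phononSpectrum hφ (T * x)
  have h2 := integrable_momentKernel_mul hω₀ hT isProfile_sq_mul_phononSpectrum hφ (T * x)
  rw [← pull_K₀ hω₀ hT, ← pull_momentKernel hω₀ hT (fun y => y) φ,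
    ← pull_momentKernel hω₀ hT (fun y => y ^ 2) φ, K₀_eq_momentKernel]
  simp only [pull, intOp, Kfull, K₁_eq_momentKernel hω₀, K₂_eq_momentKernel, K₀_eq_momentKernel]
  have e : ∀ u, (momentKernel (fun _ => 1) ω₀ T (T * x) u +
      1 / (2 * εF) * T * momentKernel (fun y => y) ω₀ T (T * x) u -
      1 / (2 * ω₀ ^ 2) * T ^ 2 * momentKernel (fun y => y ^ 2) ω₀ T (T * x) u) * φ u =
      momentKernel (fun _ => 1) ω₀ T (T * x) u * φ u +
      1 / (2 * εF) * T * (momentKernel (fun y => y) ω₀ T (T * x) u * φ u) -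
      1 / (2 * ω₀ ^ 2) * T ^ 2 * (momentKernel (fun y => y ^ 2) ω₀ T (T * x) u * φ u) :=
    fun u => by ring
  simp only [e]
  rw [integral_sub (by exact h0.add (h1.const_mul _)) (h2.const_mul _), integral_add h0 (h1.const_mul _),
    integral_const_mul, integral_const_mul]
  ring

theorem pull_inv_Γ₀ {ω₀ T : ℝ} (hω₀ : 0 < ω₀) (hT : 0 < T) (x : ℝ) :
    pull T (fun ε => 1 / Γ₀ ω₀ T ε) x = ω₀ ^ 2 / T ^ 3 * (amplitude x / rate x) := by
  rw [pull, Γ₀_eq hT, mul_div_cancel_left₀ x hT.ne']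
  have := (rate_pos x).ne'
  field_simp

theorem memLp_const_σ {ω₀ T : ℝ} (hω₀ : 0 < ω₀) (hT : 0 < T) (c : ℝ) :
    MemLp (fun _ => c) 2 (σ ω₀ T) := by
  rw [memLp_σ_iff hω₀ hT]
  exact memLp_amplitude.mul_const c

theorem integral_K₀ {ω₀ T : ℝ} (hω₀ : 0 < ω₀) (hT : 0 < T) (ε : ℝ) : ∫ u, K₀ ω₀ T ε u = 1 := by
  simp only [K₀]
  rw [integral_div, ← Γ₀, div_self (Γ₀_pos hω₀ hT ε).ne']

/-- The loss term is φ(ε) itself because the rows of K₀ integrate to 1. -/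
theorem C₀_eq {ω₀ T : ℝ} (hω₀ : 0 < ω₀) (hT : 0 < T) {φ : ℝ → ℝ} (hφ : MemLp φ 2 (σ ω₀ T))
    (ε : ℝ) : C₀ ω₀ T φ ε = intOp (K₀ ω₀ T) φ ε - φ ε := by
  have hi : ∀ {ψ : ℝ → ℝ}, MemLp ψ 2 (σ ω₀ T) → Integrable fun u => K₀ ω₀ T ε u * ψ u := by
    intro ψ hψ
    rw [K₀_eq_momentKernel]
    exact integrable_momentKernel_mul hω₀ hT isProfile_one_mul hψ ε
  rw [C₀, integral_add_right_eq_self (fun u => K₀ ω₀ T ε u * (φ u - φ ε)) ε, intOp]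
  simp only [mul_sub]
  rw [integral_sub (hi hφ) (hi (memLp_const_σ hω₀ hT (φ ε))), integral_mul_const,
    integral_K₀ hω₀ hT, one_mul]

theorem Γ₁_div_Γ₀ (ω₀ εF T ε : ℝ) :
    Γ₁ ω₀ εF T ε / Γ₀ ω₀ T ε = intOp (K₁ ω₀ εF T) (fun _ => 1) ε := by
  simp only [intOp, K₁, mul_one]
  rw [integral_div, Γ₁]

/-! ### Dictionary between functions of energy and vectors of L²(ℝ) -/

/-- `φ ∈ L²_σ` is represented by `X ∈ L²(ℝ)` after rescaling. -/
def Represents (T : ℝ) (φ : ℝ → ℝ) (X : L2R) : Prop := pull T φ =ᵐ[volume] X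

section Represents

variable {ω₀ T : ℝ}

theorem Represents.memLp (hω₀ : 0 < ω₀) (hT : 0 < T) {φ : ℝ → ℝ} {X : L2R}
    (h : Represents T φ X) : MemLp φ 2 (σ ω₀ T) :=
  (memLp_σ_iff hω₀ hT).2 ((memLp_congr_ae h).2 (Lp.memLp X))

theorem exists_represents (hω₀ : 0 < ω₀) (hT : 0 < T) {φ : ℝ → ℝ} (h : MemLp φ 2 (σ ω₀ T)) :
    ∃ X, Represents T φ X :=
  ⟨((memLp_σ_iff hω₀ hT).1 h).toLp _, ((memLp_σ_iff hω₀ hT).1 h).coeFn_toLp.symm⟩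

theorem represents_push (hT : 0 < T) (X : L2R) : Represents T (push T X) X := by
  rw [Represents, pull_push hT]

theorem Represents.eq_iff (hT : 0 < T) {φ ψ : ℝ → ℝ} {X Y : L2R} (hX : Represents T φ X)
    (hY : Represents T ψ Y) : (∀ᵐ ε, φ ε = ψ ε) ↔ X = Y := by
  rw [← pull_ae_eq_iff hT, Lp.ext_iff]
  exact ⟨fun h => hX.symm.trans (h.trans hY), fun h => hX.trans (h.trans hY.symm)⟩

theorem Represents.add {φ ψ : ℝ → ℝ} {X Y : L2R} (hX : Represents T φ X)
    (hY : Represents T ψ Y) : Represents T (fun ε => φ ε + ψ ε) (X + Y) := by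
  filter_upwards [hX, hY, Lp.coeFn_add X Y] with x h1 h2 h3
  rw [h3, Pi.add_apply, ← h1, ← h2, pull, pull, pull, mul_add]

theorem Represents.sub {φ ψ : ℝ → ℝ} {X Y : L2R} (hX : Represents T φ X)
    (hY : Represents T ψ Y) : Represents T (fun ε => φ ε - ψ ε) (X - Y) := by
  filter_upwards [hX, hY, Lp.coeFn_sub X Y] with x h1 h2 h3
  rw [h3, Pi.sub_apply, ← h1, ← h2, pull, pull, pull, mul_sub]

theorem Represents.const_mul (c : ℝ) {φ : ℝ → ℝ} {X : L2R} (hX : Represents T φ X) :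
    Represents T (fun ε => c * φ ε) (c • X) := by
  filter_upwards [hX, Lp.coeFn_smul c X] with x h1 h2
  rw [h2, Pi.smul_apply, ← h1, pull, pull, smul_eq_mul]
  ring

theorem Represents.comp_neg {φ : ℝ → ℝ} {X : L2R} (hX : Represents T φ X) :
    Represents T (fun ε => φ (-ε)) (parity X) := by
  filter_upwards [ae_neg hX, parity_ae X] with x h1 h2
  rw [h2, ← h1, pull, pull, amplitude_neg, mul_neg]

theorem Represents.evenPart {φ : ℝ → ℝ} {X : L2R} (hX : Represents T φ X) :
    Represents T (evenPart φ) ((1 / 2 : ℝ) • (X + model.N X)) := by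
  have h := (hX.add hX.comp_neg).const_mul (1 / 2)
  have e : ElectronPhonon.evenPart φ = fun ε => 1 / 2 * (φ ε + φ (-ε)) := by
    funext ε; rw [ElectronPhonon.evenPart]; ring
  rw [e]
  exact h

theorem Represents.oddPart {φ : ℝ → ℝ} {X : L2R} (hX : Represents T φ X) :
    Represents T (oddPart φ) ((1 / 2 : ℝ) • (X - model.N X)) := by
  have h := (hX.sub hX.comp_neg).const_mul (1 / 2)
  have e : ElectronPhonon.oddPart φ = fun ε => 1 / 2 * (φ ε - φ (-ε)) := by
    funext ε; rw [ElectronPhonon.oddPart]; ring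
  rw [e]
  exact h

theorem represents_const (c : ℝ) : Represents T (fun _ => c) (c • model.v) := by
  filter_upwards [memLp_amplitude.coeFn_toLp, Lp.coeFn_smul c model.v] with x h1 h2
  have h3 : model.v x = amplitude x := h1
  rw [h2, Pi.smul_apply, h3, pull, smul_eq_mul, mul_comm]

theorem represents_inv_Γ₀ (hω₀ : 0 < ω₀) (hT : 0 < T) :
    Represents T (fun ε => 1 / Γ₀ ω₀ T ε) ((ω₀ ^ 2 / T ^ 3) • model.q) := by
  filter_upwards [memLp_amplitude_div_rate.coeFn_toLp,
    Lp.coeFn_smul (ω₀ ^ 2 / T ^ 3) model.q] with x h1 h2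
  rw [h2, Pi.smul_apply, model, h1, pull_inv_Γ₀ hω₀ hT, smul_eq_mul]

theorem Represents.intOp_K₀ (hω₀ : 0 < ω₀) (hT : 0 < T) {φ : ℝ → ℝ} {X : L2R}
    (hX : Represents T φ X) : Represents T (intOp (K₀ ω₀ T) φ) (model.K X) := by
  rw [Represents, pull_K₀ hω₀ hT, symOp_congr hX]
  exact (symCLM_ae isProfile_phononSpectrum X).symm

theorem Represents.intOp_K₁ (hω₀ : 0 < ω₀) (hT : 0 < T) (εF : ℝ) {φ : ℝ → ℝ} {X : L2R}
    (hX : Represents T φ X) :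
    Represents T (intOp (K₁ ω₀ εF T) φ) ((1 / (2 * εF) * T) • model.A X) := by
  filter_upwards [symCLM_ae isProfile_id_mul_phononSpectrum X,
    Lp.coeFn_smul (1 / (2 * εF) * T) (model.A X)] with x h1 h2
  rw [h2, Pi.smul_apply, model, h1, pull_K₁ hω₀ hT, symOp_congr hX, smul_eq_mul]

theorem Represents.intOp_Kfull (hω₀ : 0 < ω₀) (hT : 0 < T) (εF : ℝ) {φ : ℝ → ℝ} {X : L2R}
    (hX : Represents T φ X) :
    Represents T (intOp (Kfull ω₀ εF T) φ) (model.K X + (1 / (2 * εF) * T) • model.A X -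
      (1 / (2 * ω₀ ^ 2) * T ^ 2) • model.B X) := by
  filter_upwards [symCLM_ae isProfile_phononSpectrum X,
    symCLM_ae isProfile_id_mul_phononSpectrum X, symCLM_ae isProfile_sq_mul_phononSpectrum X,
    Lp.coeFn_smul (1 / (2 * εF) * T) (model.A X),
    Lp.coeFn_smul (1 / (2 * ω₀ ^ 2) * T ^ 2) (model.B X),
    Lp.coeFn_add (model.K X) ((1 / (2 * εF) * T) • model.A X),
    Lp.coeFn_sub (model.K X + (1 / (2 * εF) * T) • model.A X)
      ((1 / (2 * ω₀ ^ 2) * T ^ 2) • model.B X)] with x h1 h2 h3 h4 h5 h6 h7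
  rw [h7, Pi.sub_apply, h6, Pi.add_apply, h4, h5, Pi.smul_apply, Pi.smul_apply,
    pull_Kfull hω₀ hT εF (hX.memLp hω₀ hT), symOp_congr hX, symOp_congr hX, symOp_congr hX,
    ← h1, ← h2, ← h3]
  rfl

theorem Represents.iterate (hω₀ : 0 < ω₀) (hT : 0 < T) {φ : ℝ → ℝ} {X : L2R}
    (hX : Represents T φ X) (n : ℕ) :
    Represents T ((intOp (K₀ ω₀ T))^[n] φ) ((model.K ^ n) X) := by
  induction n with
  | zero => simpa using hX
  | succ n ih =>
    rw [Function.iterate_succ_apply', pow_succ', mul_apply_eq_comp]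
    exact ih.intOp_K₀ hω₀ hT

theorem represents_zero : Represents T (fun _ => 0) 0 := by
  have := represents_const (T := T) 0
  rwa [zero_smul] at this

theorem Represents.sum (hω₀ : 0 < ω₀) (hT : 0 < T) {φ : ℝ → ℝ} {X : L2R}
    (hX : Represents T φ X) (n : ℕ) :
    Represents T (fun ε => ∑ m ∈ Finset.range n, (intOp (K₀ ω₀ T))^[m] φ ε)
      (∑ m ∈ Finset.range n, (model.K ^ m) X) := by
  induction n with
  | zero => simpa using represents_zero
  | succ n ih =>
    simp only [Finset.sum_range_succ]
    exact ih.add (hX.iterate hω₀ hT n)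

theorem Represents.hasNeumannSum (hω₀ : 0 < ω₀) (hT : 0 < T) {φ S : ℝ → ℝ} {X : L2R}
    (hX : Represents T φ X) (hv : ⟪model.v, X⟫ = 0) (hS : Represents T S (model.neumann X)) :
    HasNeumannSum ω₀ T φ S := by
  refine ⟨fun m => (hX.iterate hω₀ hT m).memLp hω₀ hT, hS.memLp hω₀ hT, ?_⟩
  have h : ∀ n, eLpNorm (fun ε => (∑ m ∈ Finset.range n, (intOp (K₀ ω₀ T))^[m] φ ε) - S ε) 2
      (σ ω₀ T) = ENNReal.ofReal (T ^ 2 / ω₀ *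
        ‖∑ m ∈ Finset.range n, (model.K ^ m) X - model.neumann X‖) := fun n =>
    eLpNorm_σ_of_ae hω₀ hT ((hX.sum hω₀ hT n).sub hS)
  simp only [h]
  have hlim := (model.summable_neumann X hv).hasSum.tendsto_sum_nat
  have h2 := (((hlim.sub_const (model.neumann X)).norm).const_mul (T ^ 2 / ω₀))
  have h3 := ENNReal.tendsto_ofReal h2
  simpa [LowTemperatureModel.neumann] using h3

theorem Represents.odd_iff (hT : 0 < T) {φ : ℝ → ℝ} {X : L2R} (hX : Represents T φ X) :
    (∀ᵐ ε, φ (-ε) = -φ ε) ↔ model.N X = -X := by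
  have h := hX.comp_neg.eq_iff hT (hX.const_mul (-1))
  simp only [neg_one_mul, neg_one_smul] at h
  exact h

theorem Represents.isSolution_iff (hω₀ : 0 < ω₀) (hT : 0 < T) (εF : ℝ) {φ : ℝ → ℝ} {X : L2R}
    (hX : Represents T φ X) : IsSolution ω₀ εF T φ ↔
      model.pencil (1 / (2 * εF)) (1 / (2 * ω₀ ^ 2)) T X = (ω₀ ^ 2 / T ^ 3) • model.q := by
  have h := hX.eq_iff hT ((represents_inv_Γ₀ hω₀ hT).add (hX.intOp_Kfull hω₀ hT εF))
  rw [IsSolution, and_iff_right (hX.memLp hω₀ hT), h, LowTemperatureModel.pencil_apply]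
  constructor
  · intro e
    nth_rewrite 1 [e]
    abel
  · intro e
    rw [← e]
    abel

theorem Represents.eLpNorm_le_iff (hω₀ : 0 < ω₀) (hT : 0 < T) {φ ψ : ℝ → ℝ} {X Y : L2R}
    (hX : Represents T φ X) (hY : Represents T ψ Y) {δ : ℝ} (hδ : 0 < δ) :
    eLpNorm φ 2 (σ ω₀ T) ≤ ENNReal.ofReal δ * eLpNorm ψ 2 (σ ω₀ T) ↔ ‖X‖ ≤ δ * ‖Y‖ := by
  have hc : 0 < T ^ 2 / ω₀ := by positivity
  rw [eLpNorm_σ_of_ae hω₀ hT hX, eLpNorm_σ_of_ae hω₀ hT hY, ← ENNReal.ofReal_mul hδ.le,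
    ENNReal.ofReal_le_ofReal_iff (by positivity), mul_left_comm, mul_le_mul_iff_right₀ hc]

end Represents

/-! ### Odd response and leading-order asymptotics -/

/-- The Neumann sum of `Γ₁/Γ₀`. -/
def oddResponse (εF T : ℝ) : ℝ → ℝ :=
  push T ((1 / (2 * εF) * T) • model.neumann (model.A model.v) : L2R)

theorem represents_oddResponse {T : ℝ} (hT : 0 < T) (εF : ℝ) :
    Represents T (oddResponse εF T) ((1 / (2 * εF) * T) • model.neumann (model.A model.v)) :=
  represents_push hT _

theorem represents_Γ₁_div_Γ₀ {ω₀ T : ℝ} (hω₀ : 0 < ω₀) (hT : 0 < T) (εF : ℝ) :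
    Represents T (fun ε => Γ₁ ω₀ εF T ε / Γ₀ ω₀ T ε) ((1 / (2 * εF) * T) • model.A model.v) := by
  simp only [Γ₁_div_Γ₀]
  have h := represents_const (T := T) 1
  rw [one_smul] at h
  exact h.intOp_K₁ hω₀ hT εF

theorem exists_hasNeumannSum {ω₀ T : ℝ} (hω₀ : 0 < ω₀) (hT : 0 < T) {f : ℝ → ℝ}
    (hf : IsOddL2 ω₀ T f) : ∃ S, HasNeumannSum ω₀ T f S := by
  obtain ⟨X, hX⟩ := exists_represents hω₀ hT hf.1
  exact ⟨_, hX.hasNeumannSum hω₀ hT (model.inner_v_of_odd ((hX.odd_iff hT).1 hf.2))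
    (represents_push hT _)⟩

theorem oddResponse_spec {ω₀ T : ℝ} (hω₀ : 0 < ω₀) (hT : 0 < T) (εF : ℝ) :
    IsOddL2 ω₀ T (fun ε => Γ₁ ω₀ εF T ε / Γ₀ ω₀ T ε) ∧
    HasNeumannSum ω₀ T (fun ε => Γ₁ ω₀ εF T ε / Γ₀ ω₀ T ε) (oddResponse εF T) ∧
    IsOddL2 ω₀ T (oddResponse εF T) ∧
    ∀ (φp : ℝ) (ψ : ℝ → ℝ), IsOddL2 ω₀ T ψ →
      ((∀ᵐ ε, C₀ ω₀ T ψ ε = -intOp (K₁ ω₀ εF T) (fun _ => φp) ε) ↔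
        ∀ᵐ ε, ψ ε = φp * oddResponse εF T ε) := by
  have hΓ := represents_Γ₁_div_Γ₀ hω₀ hT εF
  have hS := represents_oddResponse hT εF
  have hAv := model.inner_v_of_odd model.N_A_v
  refine ⟨⟨hΓ.memLp hω₀ hT, (hΓ.odd_iff hT).2 ?_⟩, hΓ.hasNeumannSum hω₀ hT ?_ ?_,
    ⟨hS.memLp hω₀ hT, (hS.odd_iff hT).2 ?_⟩, ?_⟩
  · rw [map_smul, model.N_A_v, smul_neg]
  · rw [inner_smul_right, hAv, mul_zero]
  · rw [model.neumann_smul _ _ hAv]; exact hS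
  · rw [map_smul, model.N_neumann_odd _ hAv model.N_A_v, smul_neg]
  · intro φp ψ hψ
    obtain ⟨X, hX⟩ := exists_represents hω₀ hT hψ.1
    have hXv := model.inner_v_of_odd ((hX.odd_iff hT).1 hψ.2)
    have h1 : Represents T (C₀ ω₀ T ψ) (model.K X - X) := by
      rw [show C₀ ω₀ T ψ = fun ε => intOp (K₀ ω₀ T) ψ ε - ψ ε from
        funext (C₀_eq hω₀ hT hψ.1)]
      exact (hX.intOp_K₀ hω₀ hT).sub hX
    have h2 := ((represents_const (T := T) φp).intOp_K₁ hω₀ hT εF).const_mul (-1)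
    simp only [neg_one_mul] at h2
    have e2 : (-1 : ℝ) • (1 / (2 * εF) * T) • model.A (φp • model.v) =
        -((φp * (1 / (2 * εF) * T)) • model.A model.v) := by
      rw [map_smul]; module
    -- Both sides become Hilbert space equations. Oddness puts X in the complement of v, where KX -
    -- X = -c Av has the Neumann sum of c Av as its only solution.
    rw [h1.eq_iff hT h2, hX.eq_iff hT (hS.const_mul φp), e2, smul_smul]
    have hc : ∀ c : ℝ, ⟪model.v, c • model.A model.v⟫ = 0 := fun c => by
      rw [inner_smul_right, hAv, mul_zero]
    rw [← model.neumann_smul _ _ hAv]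
    constructor
    · intro h
      refine model.eq_neumann _ _ (hc _) hXv ?_
      rw [← neg_sub, h, neg_neg]
    · intro h
      have := model.neumann_sub _ (hc (φp * (1 / (2 * εF) * T)))
      rw [← h] at this
      rw [← this, neg_sub]

theorem eventually_sq_mul_le (M : ℝ) {b : ℝ} (hb : 0 < b) :
    ∀ᶠ T : ℝ in 𝓝[>] 0, T ^ 2 * M ≤ b := by
  have h : Tendsto (fun T : ℝ => T ^ 2 * M) (𝓝[>] 0) (𝓝 0) := by
    have : Tendsto (fun T : ℝ => T ^ 2 * M) (𝓝 0) (𝓝 (0 ^ 2 * M)) :=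
      ((continuous_id.pow 2).mul continuous_const).tendsto 0
    simp only [ne_eq, OfNat.ofNat_ne_zero, not_false_eq_true, zero_pow, zero_mul] at this
    exact this.mono_left nhdsWithin_le_nhds
  exact (h.eventually_lt_const hb).mono fun T hT => hT.le

/-- If `c` and `p` approximate the same vector, they are close relative to `p`. -/
theorem abs_sub_le_of_norm_sub_le {E : Type*} [NormedAddCommGroup E] [NormedSpace ℝ E] {e v : E}
    (hv : v ≠ 0) {c p δ : ℝ} (hδ : δ ≤ 1 / 3) (hc : 0 < c)
    (h1 : ‖e - c • v‖ ≤ δ * ‖c • v‖) (h2 : ‖e - p • v‖ ≤ δ * ‖p • v‖) :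
    c ≤ 2 * |p| ∧ |c - p| ≤ 3 * δ * |p| := by
  have hvn : 0 < ‖v‖ := norm_pos_iff.2 hv
  rw [norm_smul, Real.norm_eq_abs] at h1 h2
  rw [abs_of_pos hc] at h1
  have hδ0 : 0 ≤ δ := by
    have := (norm_nonneg _).trans h1
    by_contra! h
    have : δ * (c * ‖v‖) < 0 := mul_neg_of_neg_of_pos h (by positivity)
    linarith
  have h3 : |c - p| * ‖v‖ ≤ δ * (c + |p|) * ‖v‖ := by
    rw [← Real.norm_eq_abs, ← norm_smul,
      show (c - p) • v = (e - p • v) - (e - c • v) by module]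
    refine (norm_sub_le _ _).trans ?_
    linarith
  have h4 : |c - p| ≤ δ * (c + |p|) := le_of_mul_le_mul_right h3 hvn
  have h5 : c - |p| ≤ |c - p| := by
    have := le_abs_self p
    have := le_abs_self (c - p)
    linarith
  have h6 : δ * (c + |p|) ≤ 1 / 3 * (c + |p|) :=
    mul_le_mul_of_nonneg_right hδ (by positivity)
  have h7 : c ≤ 2 * |p| := by linarith
  refine ⟨h7, h4.trans ?_⟩
  have : δ * (c + |p|) ≤ δ * (3 * |p|) := mul_le_mul_of_nonneg_left (by linarith) hδ0
  linarith

/-- The error T⁻³ is smaller than the main term T⁻⁵ by a factor T². -/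
theorem leadingOrder_evenPart {ω₀ T₀ C M : ℝ} (hω₀ : 0 < ω₀) (hT₀ : 0 < T₀) (hC : 0 < C)
    {φ : ℝ → ℝ → ℝ} {X : ℝ → L2R} (hX : ∀ T, 0 < T → T < T₀ → Represents T (φ T) (X T))
    (hb : ∀ T, 0 < T → T < T₀ →
      ‖(1 / 2 : ℝ) • (X T + model.N (X T)) - (C / T ^ 5) • model.v‖ ≤ M / T ^ 3) :
    LeadingOrder ω₀ (fun T => evenPart (φ T)) (fun T _ => C / T ^ 5) := by
  intro δ hδ
  have hv : 0 < ‖model.v‖ := norm_pos_iff.2 model.v_ne_zero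
  filter_upwards [Ioo_mem_nhdsGT hT₀,
    eventually_sq_mul_le M (by positivity : 0 < δ * (C * ‖model.v‖))] with T hT hTM
  have hT0 := hT.1
  have hr := hX T hT.1 hT.2
  rw [(hr.evenPart.sub (represents_const (C / T ^ 5))).eLpNorm_le_iff hω₀ hT0
    (represents_const (C / T ^ 5)) hδ]
  refine (hb T hT.1 hT.2).trans ?_
  rw [norm_smul, Real.norm_of_nonneg (by positivity), div_mul_eq_mul_div, mul_div_assoc',
    div_le_div_iff₀ (by positivity) (by positivity)]
  have := mul_le_mul_of_nonneg_left hTM (by positivity : 0 ≤ T ^ 3)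
  linarith

theorem leadingOrder_oddPart {ω₀ εF T₀ C M : ℝ} (hω₀ : 0 < ω₀) (hεF : 0 < εF) (hT₀ : 0 < T₀)
    (hC : 0 < C) {φ : ℝ → ℝ → ℝ} {X : ℝ → L2R}
    (hX : ∀ T, 0 < T → T < T₀ → Represents T (φ T) (X T))
    (heven : LeadingOrder ω₀ (fun T => evenPart (φ T)) (fun T _ => C / T ^ 5))
    (hb : ∀ T, 0 < T → T < T₀ → ‖(1 / 2 : ℝ) • (X T - model.N (X T)) -
      (C / T ^ 5 * (1 / (2 * εF) * T)) • model.neumann (model.A model.v)‖ ≤ M / T ^ 2)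
    {φp : ℝ → ℝ} (hφp : LeadingOrder ω₀ (fun T => evenPart (φ T)) (fun T _ => φp T)) :
    LeadingOrder ω₀ (fun T => oddPart (φ T)) (fun T ε => φp T * oddResponse εF T ε) := by
  intro δ hδ
  set o := model.neumann (model.A model.v) with ho
  have hon : 0 < ‖o‖ := norm_pos_iff.2 model_neumann_ne_zero
  -- The error of the expansion costs 2δ', since c ≤ 2|φ₊|, and replacing c by φ₊ costs 3δ'. The
  -- bound 1/3 makes the two constants comparable.
  set δ' := min (δ / 5) (1 / 3) with hδ'
  have hδ'0 : 0 < δ' := by positivity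
  filter_upwards [Ioo_mem_nhdsGT hT₀, heven δ' hδ'0, hφp δ' hδ'0,
    eventually_sq_mul_le M (by positivity : 0 < δ' * (C * (1 / (2 * εF) * ‖o‖)))]
    with T hT h1 h2 hTM
  have hT0 := hT.1
  have hr := hX T hT.1 hT.2
  rw [(hr.evenPart.sub (represents_const (C / T ^ 5))).eLpNorm_le_iff hω₀ hT0
    (represents_const (C / T ^ 5)) hδ'0] at h1
  rw [(hr.evenPart.sub (represents_const (φp T))).eLpNorm_le_iff hω₀ hT0
    (represents_const (φp T)) hδ'0] at h2
  have hS := (represents_oddResponse hT0 εF).const_mul (φp T)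
  rw [(hr.oddPart.sub hS).eLpNorm_le_iff hω₀ hT0 hS hδ, ← ho]
  obtain ⟨h3, h4⟩ := abs_sub_le_of_norm_sub_le model.v_ne_zero (min_le_right _ _)
    (by positivity) h1 h2
  set c := C / T ^ 5 with hc
  set a := 1 / (2 * εF) * T with ha
  have ha0 : 0 < a := by positivity
  have hMT : M / T ^ 2 ≤ δ' * (c * (a * ‖o‖)) := by
    rw [hc, ha, div_mul_eq_mul_div, mul_div_assoc', div_le_div_iff₀ (by positivity) (by positivity)]
    have := mul_le_mul_of_nonneg_left hTM (by positivity : 0 ≤ T ^ 3)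
    linarith
  have e : (1 / 2 : ℝ) • (X T - model.N (X T)) - φp T • a • o =
      ((1 / 2 : ℝ) • (X T - model.N (X T)) - (c * a) • o) + ((c - φp T) * a) • o := by
    module
  rw [e]
  refine (norm_add_le _ _).trans ?_
  rw [norm_smul ((c - φp T) * a), norm_smul (φp T), norm_smul a, Real.norm_eq_abs,
    Real.norm_eq_abs, Real.norm_eq_abs, abs_mul, abs_of_pos ha0]
  have h5 := (hb T hT.1 hT.2).trans hMT
  have hao : 0 < a * ‖o‖ := by positivity
  have h6 : δ' * (c * (a * ‖o‖)) ≤ δ' * (2 * |φp T| * (a * ‖o‖)) :=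
    mul_le_mul_of_nonneg_left (mul_le_mul_of_nonneg_right h3 hao.le) hδ'0.le
  have h7 : |c - φp T| * (a * ‖o‖) ≤ 3 * δ' * |φp T| * (a * ‖o‖) :=
    mul_le_mul_of_nonneg_right h4 hao.le
  have h8 : 5 * δ' ≤ δ := by
    have := min_le_left (δ / 5) (1 / 3)
    linarith
  have h9 : 5 * δ' * (|φp T| * (a * ‖o‖)) ≤ δ * (|φp T| * (a * ‖o‖)) :=
    mul_le_mul_of_nonneg_right h8 (by positivity)
  linarith

end

end ElectronPhonon

open ElectronPhonon
theorem proposition3p3 (ω₀ εF : ℝ) (hω₀ : 0 < ω₀) (hεF : 0 < εF) :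
    -- the Neumann series converges on odd functions
    (∀ T : ℝ, 0 < T → ∀ f : ℝ → ℝ, IsOddL2 ω₀ T f → ∃ S, HasNeumannSum ω₀ T f S) ∧
    ∃ S : ℝ → ℝ → ℝ,
      -- `S T` is the sum of the series for `Γ₁/Γ₀`, and `φ₊ S` is the unique odd solution of the
      -- leading-order equation `C₀ φ₋ = - K₁ φ₊` with constant `φ₊`
      (∀ T : ℝ, 0 < T →
        IsOddL2 ω₀ T (fun ε => Γ₁ ω₀ εF T ε / Γ₀ ω₀ T ε) ∧
        HasNeumannSum ω₀ T (fun ε => Γ₁ ω₀ εF T ε / Γ₀ ω₀ T ε) (S T) ∧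
        IsOddL2 ω₀ T (S T) ∧
        ∀ (φp : ℝ) (ψ : ℝ → ℝ), IsOddL2 ω₀ T ψ →
          ((∀ᵐ ε, C₀ ω₀ T ψ ε = -intOp (K₁ ω₀ εF T) (fun _ => φp) ε) ↔
            ∀ᵐ ε, ψ ε = φp * S T ε)) ∧
      -- at low temperature the full integral equation has exactly one solution in `L²_σ`
      ∃ T₀ : ℝ, 0 < T₀ ∧
        (∀ T : ℝ, 0 < T → T < T₀ → ∃ φ, IsSolution ω₀ εF T φ ∧
          ∀ φ', IsSolution ω₀ εF T φ' → ∀ᵐ ε, φ' ε = φ ε) ∧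
        ∀ φ : ℝ → ℝ → ℝ, (∀ T : ℝ, 0 < T → T < T₀ → IsSolution ω₀ εF T (φ T)) →
          -- the even part is to leading order a constant, which scales as `T⁻⁵`
          (∃ C : ℝ, 0 < C ∧
            LeadingOrder ω₀ (fun T => evenPart (φ T)) (fun T _ => C / T ^ 5)) ∧
          -- with that constant `φ₊`, the odd part is to leading order `φ₊ ∑ (K₀)^m (Γ₁/Γ₀)`
          ∀ φp : ℝ → ℝ, LeadingOrder ω₀ (fun T => evenPart (φ T)) (fun T _ => φp T) →
            LeadingOrder ω₀ (fun T => oddPart (φ T)) (fun T ε => φp T * S T ε) := by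
  refine ⟨fun T hT f hf => exists_hasNeumannSum hω₀ hT hf, oddResponse εF,
    fun T hT => oddResponse_spec hω₀ hT εF, ?_⟩
  have hβ : 0 < 1 / (2 * ω₀ ^ 2) := by positivity
  have hΩ : 0 < ω₀ ^ 2 := by positivity
  obtain ⟨T₀, M, hT₀, hmain⟩ := model.low_temperature_asymptotics (1 / (2 * εF)) hβ hΩ
  have hC := model.leadingCoeff_pos (1 / (2 * εF)) hβ hΩ
  refine ⟨T₀, hT₀, fun T hT hTT => ?_, fun φ hφ => ?_⟩
  · obtain ⟨X, hX⟩ := (hmain T hT hTT).1.2 ((ω₀ ^ 2 / T ^ 3) • model.q)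
    have hr := represents_push hT X
    refine ⟨push T X, (hr.isSolution_iff hω₀ hT εF).2 hX, fun φ' hφ' => ?_⟩
    obtain ⟨Y, hY⟩ := exists_represents hω₀ hT hφ'.1
    exact (hY.eq_iff hT hr).2
      ((hmain T hT hTT).1.1 (((hY.isSolution_iff hω₀ hT εF).1 hφ').trans hX.symm))
  · have hex : ∀ T, ∃ X, 0 < T → T < T₀ → Represents T (φ T) X := by
      intro T
      by_cases h : 0 < T ∧ T < T₀
      · obtain ⟨X, hX⟩ := exists_represents hω₀ h.1 (hφ T h.1 h.2).1
        exact ⟨X, fun _ _ => hX⟩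
      · exact ⟨0, fun h1 h2 => absurd ⟨h1, h2⟩ h⟩
    choose X hX using hex
    have hb := fun T hT hTT => (hmain T hT hTT).2 (X T)
      (((hX T hT hTT).isSolution_iff hω₀ hT εF).1 (hφ T hT hTT))
    have heven := leadingOrder_evenPart hω₀ hT₀ hC hX fun T hT hTT => (hb T hT hTT).1
    exact ⟨⟨_, hC, heven⟩, fun φp hφp =>
      leadingOrder_oddPart hω₀ hεF hT₀ hC hX heven (fun T hT hTT => (hb T hT hTT).2) hφp⟩
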